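/- Let $n\ge 1$ and let $W=(W_t)_{t\ge 0}$ be standard Brownian motion in $\mathbb{R}^n$ started at the origin, i.e. its coordinates are independent standard one-dimensional Brownian motions. For $t\ge 0$ let $\mathcal{H}_t=\operatorname{conv}\{W_s: 0\le s\le t\}$ be the convex hull of the path up to time $t$, let $D_t$ be the (Euclidean) diameter of $\mathcal{H}_t$, and let $$\Theta_1^D=\inf\{t\ge 0: D_t>1\}$$ be the first time the diameter of the hull exceeds $1$. Then $$\frac{1}{4\log 2}\cdot\frac1n\;\le\;\mathbb{E}\left[\Theta_1^D\right]\;\le\;\frac1n .$$ -/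

import Mathlib

open MeasureTheory ProbabilityTheory
open scoped NNReal ENNReal

namespace BrownianHull

/-- `W` is a standard Brownian motion in `ℝⁿ` starting at the origin: each coordinate is a standard
real Brownian motion (almost surely continuous paths, starting at `0` almost surely), and the
coordinate processes are independent. -/
structure IsBrownianMotion {Ω : Type*} [MeasurableSpace Ω] {n : ℕ}
    (W : ℝ≥0 → Ω → EuclideanSpace ℝ (Fin n)) (P : Measure Ω) : Prop where
  coord : ∀ j : Fin n, IsBrownianReal (fun t ω => W t ω j) P
  indep : iIndepFun (fun (j : Fin n) (ω : Ω) (t : ℝ≥0) => W t ω j) P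

/-- The convex hull `H_t` of the path `w` run up to time `t`. -/
def hull {n : ℕ} (w : ℝ≥0 → EuclideanSpace ℝ (Fin n)) (t : ℝ≥0) :
    Set (EuclideanSpace ℝ (Fin n)) :=
  convexHull ℝ (w '' Set.Icc 0 t)

/-- The diameter `D_t` of the hull `H_t`, as an extended nonnegative real (it is finite when the
path is continuous). -/
noncomputable def hullDiameter {n : ℕ} (w : ℝ≥0 → EuclideanSpace ℝ (Fin n)) (t : ℝ≥0) : ℝ≥0∞ :=
  Metric.ediam (hull w t)

/-- The inverse process `Θ_y = inf {t ≥ 0 : X_t > y}` of a functional `X`, with values in `[0, ∞]`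
(`inf ∅ = ∞`). -/
noncomputable def inverseProcess (X : ℝ≥0 → ℝ≥0∞) (y : ℝ≥0) : ℝ≥0∞ :=
  sInf {s : ℝ≥0∞ | ∃ t : ℝ≥0, s = (t : ℝ≥0∞) ∧ (y : ℝ≥0∞) < X t}

/-- The inverse diameter time `Θ_y^D = inf {t ≥ 0 : D_t > y}` of the process `W` at the sample
point `ω`. -/
noncomputable def inverseDiameterTime {Ω : Type*} {n : ℕ}
    (W : ℝ≥0 → Ω → EuclideanSpace ℝ (Fin n)) (y : ℝ≥0) (ω : Ω) : ℝ≥0∞ :=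
  inverseProcess (hullDiameter (fun t => W t ω)) y

end BrownianHull

/-! Upper bound. As long as the diameter is at most `1`, the path is within distance `1` of its
starting point `0`, so `Θ` is at most the exit time from the unit ball, whose mean is `1/n` by
optional stopping for `|W_t|² - n t`. The stopping is done on a grid of mesh `h = T/N`, where no
stopped continuous martingale is needed. The overshoot at the exit is paid for by fourth moments of
the increments, with total `O(N h²) = O(T²/N)`, which vanishes as `N → ∞` (`sum_stays_mul_le`,
`sum_integral_stays_le`, `measure_le_integral_stays`).

Lower bound. By scaling, `D_t` has the law of `√t D_1`, so `E Θ ≥ E[D_1⁻²] ≥ 1 / E[D_1²]` by Jensen.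
Since `D_1²` is at most the sum of the squared coordinate ranges, it remains to show `E[R_1²] ≤ 4
log 2` for the range `R` of real Brownian motion `B`.

For this, let `τ` be an independent exponential time of rate `1`. Since `E[τ] = 1`, scaling gives
`E[R_τ²] = E[R_1²]`. With `M` and `m` the running maximum and minimum, the process `e^{-t} (cosh(√2
(M - B)) + cosh(√2 (B - m))) / 2` starts at `1`. When the range reaches `r`, `B` is at `M` or `m`,
and the process is `e^{-t} (1 + cosh(√2 r)) / 2 = e^{-t} cosh²(r/√2)`. Hence `P(R_τ ≥ r) ≤ 1 /
cosh²(r/√2)`, and `∫ 2r / cosh²(r/√2) dr = 4 log 2`. All of this is carried out for Gaussian walks,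
where the process is a supermartingale by a one-step inequality (`rangePotential_succ_le`,
`IsGaussianWalk.sum_tail_le`, `IsGaussianWalk.sum_sq_le`). Fatou's lemma along finer grids transfers
the bound to Brownian motion (`lintegral_exp_mul_sq_ediam_le`). -/

namespace BrownianHull

/-! ### The range of a Gaussian walk at a geometric time. -/

section Walk

/-- The range `max_{i ≤ k} x i - min_{i ≤ k} x i` of a real sequence up to time `k`. -/
noncomputable def seqRange (x : ℕ → ℝ) (k : ℕ) : ℝ := partialSups x k + partialSups (-x) k

/-- The average of `cosh (√2 (max x - x k))` and `cosh (√2 (x k - min x))`. -/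
noncomputable def rangePotential (x : ℕ → ℝ) (k : ℕ) : ℝ :=
  (Real.cosh (√2 * (partialSups x k - x k)) + Real.cosh (√2 * (partialSups (-x) k + x k))) / 2

/-- The running maximum only depends on the past. -/
lemma partialSups_comp_min {α : Type*} [SemilatticeSup α] (x : ℕ → α) (k : ℕ) :
    partialSups (fun i ↦ x (min i k)) k = partialSups x k := by
  rw [partialSups_apply, partialSups_apply]
  exact Finset.sup'_congr _ rfl fun i hi ↦ by rw [min_eq_left (Finset.mem_Iic.1 hi)]

lemma seqRange_comp_min (x : ℕ → ℝ) (k : ℕ) :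
    seqRange (fun i ↦ x (min i k)) k = seqRange x k := by
  rw [seqRange, seqRange, partialSups_comp_min]
  congr 1
  exact partialSups_comp_min (-x) k

lemma seqRange_mono (x : ℕ → ℝ) : Monotone (seqRange x) := fun _ _ h ↦
  add_le_add ((partialSups x).mono h) ((partialSups (-x)).mono h)

lemma abs_sub_le_seqRange (x : ℕ → ℝ) {i j k : ℕ} (hi : i ≤ k) (hj : j ≤ k) :
    |x i - x j| ≤ seqRange x k := by
  have h1 := le_partialSups_of_le x hi
  have h2 := le_partialSups_of_le x hj
  have h3 := le_partialSups_of_le (-x) hi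
  have h4 := le_partialSups_of_le (-x) hj
  simp only [Pi.neg_apply] at h3 h4
  rw [abs_sub_le_iff, seqRange]
  constructor <;> linarith

lemma seqRange_nonneg (x : ℕ → ℝ) (k : ℕ) : 0 ≤ seqRange x k :=
  (abs_nonneg _).trans (abs_sub_le_seqRange x le_rfl le_rfl)

lemma seqRange_zero (x : ℕ → ℝ) : seqRange x 0 = 0 := by simp [seqRange]

lemma rangePotential_zero (x : ℕ → ℝ) : rangePotential x 0 = 1 := by simp [rangePotential]

/-- Truncation at `0` only shrinks `|y|`. Setting a new extremum is such a truncation of the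
distance to the old one, so it can only lower the potential. -/
lemma cosh_max_zero_le (c y : ℝ) : Real.cosh (c * max y 0) ≤ Real.cosh (c * y) := by
  rw [Real.cosh_le_cosh, abs_mul, abs_mul]
  refine mul_le_mul_of_nonneg_left ?_ (abs_nonneg c)
  rcases le_total y 0 with h | h
  · simp [max_eq_right h]
  · simp [max_eq_left h]

lemma partialSups_succ_sub (x : ℕ → ℝ) (k : ℕ) :
    partialSups x (k + 1) - x (k + 1) = max (partialSups x k - x (k + 1)) 0 := by
  rw [partialSups_add_one, ← sub_self (x (k + 1)), max_sub_sub_right]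

/-- One step of the potential, bounded by exponentials of the increment. -/
lemma rangePotential_succ_le (x : ℕ → ℝ) (k : ℕ) :
    rangePotential x (k + 1) ≤
      (Real.exp (√2 * (partialSups x k - x k)) + Real.exp (-(√2 * (partialSups (-x) k + x k)))) / 4
        * Real.exp (-√2 * (x (k + 1) - x k)) +
      (Real.exp (-(√2 * (partialSups x k - x k))) + Real.exp (√2 * (partialSups (-x) k + x k))) / 4
        * Real.exp (√2 * (x (k + 1) - x k)) := by
  have h1 := cosh_max_zero_le √2 (partialSups x k - x (k + 1))
  have h2 := cosh_max_zero_le √2 (partialSups (-x) k - (-x) (k + 1))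
  rw [← partialSups_succ_sub] at h1 h2
  simp only [Pi.neg_apply, sub_neg_eq_add] at h2
  rw [rangePotential]
  refine (div_le_div_of_nonneg_right (add_le_add h1 h2) zero_le_two).trans_eq ?_
  rw [div_mul_eq_mul_div, div_mul_eq_mul_div, add_mul, add_mul, ← Real.exp_add, ← Real.exp_add,
    ← Real.exp_add, ← Real.exp_add, Real.cosh_eq, Real.cosh_eq]
  ring_nf

lemma rangePotential_eq (x : ℕ → ℝ) (k : ℕ) :
    rangePotential x k =
      (Real.exp (√2 * (partialSups x k - x k)) +
        Real.exp (-(√2 * (partialSups (-x) k + x k)))) / 4 +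
      (Real.exp (-(√2 * (partialSups x k - x k))) +
        Real.exp (√2 * (partialSups (-x) k + x k))) / 4 := by
  rw [rangePotential, Real.cosh_eq, Real.cosh_eq]
  ring

/-- When the range grows, the walk sits at an end of its range. -/
lemma cosh_sq_le_rangePotential (x : ℕ → ℝ) (k : ℕ) {r : ℝ} (hr : 0 ≤ r)
    (h1 : seqRange x k < r) (h2 : r ≤ seqRange x (k + 1)) :
    Real.cosh (r / √2) ^ 2 ≤ rangePotential x (k + 1) := by
  have h2' := h1.trans_le h2
  -- Half-angle formula: `(1 + cosh(2u)) / 2 = cosh² u` with `u = r/√2`.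
  have key : Real.cosh (r / √2) ^ 2 ≤ (1 + Real.cosh (√2 * seqRange x (k + 1))) / 2 := by
    have : Real.cosh (√2 * r) ≤ Real.cosh (√2 * seqRange x (k + 1)) := by
      rw [Real.cosh_le_cosh, abs_of_nonneg (by positivity),
        abs_of_nonneg (by positivity [hr.trans h2])]
      gcongr
    have e : √2 * r = 2 * (r / √2) := by
      field_simp
      rw [Real.sq_sqrt zero_le_two, mul_comm]
    have h3 := Real.cosh_sq (r / √2)
    rw [e, Real.cosh_two_mul] at this
    linarith
  -- If neither extremum were beaten, the range would not have grown.
  have h3 : partialSups x k < x (k + 1) ∨ partialSups (-x) k < -x (k + 1) := by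
    by_contra! h
    have e1 := partialSups_add_one x k
    have e2 := partialSups_add_one (-x) k
    rw [sup_eq_left.2 h.1] at e1
    rw [sup_eq_left.2 (by simpa using h.2)] at e2
    rw [seqRange, seqRange, e1, e2] at h2'
    exact lt_irrefl _ h2'
  refine key.trans_eq ?_
  rw [rangePotential]
  rcases h3 with h | h
  · have e1 : partialSups x (k + 1) = x (k + 1) := by
      rw [partialSups_add_one]; exact sup_eq_right.2 h.le
    rw [seqRange, e1, sub_self, mul_zero, Real.cosh_zero, add_comm (x (k + 1))]
  · have e1 : partialSups (-x) (k + 1) = -x (k + 1) := by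
      rw [partialSups_add_one]; exact sup_eq_right.2 h.le
    rw [seqRange, e1, neg_add_cancel, mul_zero, Real.cosh_zero, add_comm 1, sub_eq_add_neg]

@[fun_prop]
lemma measurable_partialSups (k : ℕ) : Measurable fun x : ℕ → ℝ ↦ partialSups x k := by
  induction k with
  | zero => simp only [partialSups_zero]; fun_prop
  | succ k ih => simp only [partialSups_add_one]; fun_prop

@[fun_prop]
lemma measurable_seqRange (k : ℕ) : Measurable fun x : ℕ → ℝ ↦ seqRange x k := by
  unfold seqRange
  exact (measurable_partialSups k).add ((measurable_partialSups k).comp measurable_neg)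

@[fun_prop]
lemma measurable_rangePotential (k : ℕ) : Measurable fun x : ℕ → ℝ ↦ rangePotential x k := by
  have : Measurable fun x : ℕ → ℝ ↦ partialSups (-x) k :=
    (measurable_partialSups k).comp measurable_neg
  unfold rangePotential
  fun_prop

variable {Ω : Type*} [MeasurableSpace Ω]

/-- A random walk with independent centred Gaussian increments of variance `h`. -/
structure IsGaussianWalk (X : ℕ → Ω → ℝ) (h : ℝ≥0) (P : Measure Ω) : Prop where
  aemeasurable : ∀ i, AEMeasurable (X i) P
  indep : ∀ k, IndepFun (X (k + 1) - X k) (fun ω i ↦ X (min i k) ω) P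
  law : ∀ k, HasLaw (X (k + 1) - X k) (gaussianReal 0 h) P

lemma lintegral_exp_mul_gaussian {P : Measure Ω} {D : Ω → ℝ} {h : ℝ≥0}
    (hD : HasLaw D (gaussianReal 0 h) P) (c : ℝ) :
    ∫⁻ ω, ENNReal.ofReal (Real.exp (c * D ω)) ∂P = ENNReal.ofReal (Real.exp (h * c ^ 2 / 2)) := by
  have hm := mgf_gaussianReal hD.map_eq c
  rw [zero_mul, zero_add] at hm
  have hi : Integrable (fun ω ↦ Real.exp (c * D ω)) P := by
    have := hD.isProbabilityMeasure
    rw [← mgf_pos_iff, hm]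
    exact Real.exp_pos _
  rw [← ofReal_integral_eq_lintegral_ofReal hi (ae_of_all _ fun _ ↦ (Real.exp_pos _).le), ← hm, mgf]

/-- Factorisation of an exponential of the next increment. -/
lemma IsGaussianWalk.lintegral_mul_exp {X : ℕ → Ω → ℝ} {h : ℝ≥0} {P : Measure Ω}
    (hX : IsGaussianWalk X h P) (k : ℕ) {g : (ℕ → ℝ) → ℝ≥0∞} (hg : Measurable g)
    (hgk : ∀ x : ℕ → ℝ, g (fun i ↦ x (min i k)) = g x) (c : ℝ) :
    ∫⁻ ω, g (X · ω) * ENNReal.ofReal (Real.exp (c * (X (k + 1) ω - X k ω))) ∂P =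
      (∫⁻ ω, g (X · ω) ∂P) * ENNReal.ofReal (Real.exp (h * c ^ 2 / 2)) := by
  have hind := ((hX.indep k).symm).comp hg
    (show Measurable fun y : ℝ ↦ ENNReal.ofReal (Real.exp (c * y)) by fun_prop)
  have hm : AEMeasurable (fun ω i ↦ X i ω) P := aemeasurable_pi_lambda _ hX.aemeasurable
  have h1 := hX.aemeasurable (k + 1)
  have h2 := hX.aemeasurable k
  have e : (g ∘ fun ω i ↦ X (min i k) ω) = fun ω ↦ g (X · ω) := by
    funext ω
    exact hgk (X · ω)
  rw [e] at hind
  have := lintegral_mul_eq_lintegral_mul_lintegral_of_indepFun''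
    (hg.comp_aemeasurable hm) (by simp only [Function.comp_def, Pi.sub_apply]; fun_prop) hind
  simp only [Function.comp_def, Pi.sub_apply] at this
  rw [this]
  congr 1
  exact lintegral_exp_mul_gaussian (hX.law k) c

/-- One step of the potential on an event of the past. -/
lemma IsGaussianWalk.lintegral_rangePotential_succ_le {X : ℕ → Ω → ℝ} {h : ℝ≥0} {P : Measure Ω}
    (hX : IsGaussianWalk X h P) (k : ℕ) {g : (ℕ → ℝ) → ℝ≥0∞} (hg : Measurable g)
    (hgk : ∀ x : ℕ → ℝ, g (fun i ↦ x (min i k)) = g x) :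
    ∫⁻ ω, g (X · ω) * ENNReal.ofReal (rangePotential (X · ω) (k + 1)) ∂P ≤
      ENNReal.ofReal (Real.exp h) *
        ∫⁻ ω, g (X · ω) * ENNReal.ofReal (rangePotential (X · ω) k) ∂P := by
  have hm : AEMeasurable (fun ω i ↦ X i ω) P := aemeasurable_pi_lambda _ hX.aemeasurable
  let a (x : ℕ → ℝ) : ℝ :=
    (Real.exp (√2 * (partialSups x k - x k)) + Real.exp (-(√2 * (partialSups (-x) k + x k)))) / 4
  let b (x : ℕ → ℝ) : ℝ :=
    (Real.exp (-(√2 * (partialSups x k - x k))) + Real.exp (√2 * (partialSups (-x) k + x k))) / 4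
  have hneg : Measurable fun x : ℕ → ℝ ↦ partialSups (-x) k :=
    (measurable_partialSups k).comp measurable_neg
  have ma : Measurable a := by fun_prop
  have mb : Measurable b := by fun_prop
  have a0 x : 0 ≤ a x := by positivity
  have b0 x : 0 ≤ b x := by positivity
  have hpm (x : ℕ → ℝ) : partialSups (-fun i ↦ x (min i k)) k = partialSups (-x) k :=
    partialSups_comp_min (-x) k
  have ak x : a (fun i ↦ x (min i k)) = a x := by
    simp only [a, hpm, partialSups_comp_min, min_self]
  have bk x : b (fun i ↦ x (min i k)) = b x := by
    simp only [b, hpm, partialSups_comp_min, min_self]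
  -- The frequency `√2` makes each exponential grow by exactly `e^h` per step, matching the unit
  -- killing rate.
  have e2 (c : ℝ) (hc : c ^ 2 = 2) : Real.exp (h * c ^ 2 / 2) = Real.exp h := by
    rw [hc]; congr 1; ring
  have hs : (√2 : ℝ) ^ 2 = 2 := Real.sq_sqrt zero_le_two
  have I1 := hX.lintegral_mul_exp k (g := fun x ↦ g x * ENNReal.ofReal (a x)) (by fun_prop)
    (fun x ↦ by rw [hgk, ak]) (-√2)
  have I2 := hX.lintegral_mul_exp k (g := fun x ↦ g x * ENNReal.ofReal (b x)) (by fun_prop)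
    (fun x ↦ by rw [hgk, bk]) √2
  rw [e2 _ (by rw [neg_sq, hs])] at I1
  rw [e2 _ hs] at I2
  have mx k := hX.aemeasurable k
  have mga : AEMeasurable (fun ω ↦ g (X · ω) * ENNReal.ofReal (a (X · ω))) P := by fun_prop
  calc _ ≤ ∫⁻ ω, (g (X · ω) * ENNReal.ofReal (a (X · ω)) *
          ENNReal.ofReal (Real.exp (-√2 * (X (k + 1) ω - X k ω))) +
        g (X · ω) * ENNReal.ofReal (b (X · ω)) *
          ENNReal.ofReal (Real.exp (√2 * (X (k + 1) ω - X k ω)))) ∂P := by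
        refine lintegral_mono fun ω ↦ ?_
        rw [mul_assoc, mul_assoc, ← mul_add, ← ENNReal.ofReal_mul (a0 _),
          ← ENNReal.ofReal_mul (b0 _), ← ENNReal.ofReal_add (by positivity) (by positivity)]
        gcongr
        exact rangePotential_succ_le (X · ω) k
    _ = (∫⁻ ω, g (X · ω) * ENNReal.ofReal (a (X · ω)) ∂P +
          ∫⁻ ω, g (X · ω) * ENNReal.ofReal (b (X · ω)) ∂P) * ENNReal.ofReal (Real.exp h) := by
        rw [lintegral_add_left' (by fun_prop), I1, I2, add_mul]
    _ = _ := by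
        rw [← lintegral_add_left' mga, mul_comm]
        congr 1
        refine lintegral_congr fun ω ↦ ?_
        rw [← mul_add, ← ENNReal.ofReal_add (a0 _) (b0 _), rangePotential_eq]

/-- Summation by parts for a discounted supermartingale inequality. -/
lemma mul_sum_le_of_supermartingale {q w p e : ℕ → ℝ≥0∞} {c C : ℝ≥0∞}
    (hqw : ∀ k, q (k + 1) + w k = q k) (hqc : ∀ k, q (k + 1) * c = q k)
    (step : ∀ k, e (k + 1) + C * p (k + 1) ≤ c * e k + C * p k)
    (he : e 0 = 1) (hp : p 0 = 0) (hq : q 0 = 1) (N : ℕ) :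
    C * ∑ k ∈ Finset.range N, w k * p k ≤ 1 := by
  -- The inner bracket is `∑ q (k+1) (p (k+1) - p k)`, the discounted stopping mass, summed by parts
  -- so that no subtraction occurs in `ℝ≥0∞`.
  have main : ∀ N, q N * e N + C * (q N * p N + ∑ k ∈ Finset.range N, w k * p k) ≤ 1 := by
    intro N
    induction N with
    | zero => simp [he, hp, hq]
    | succ N ih =>
      refine le_trans ?_ ih
      have h1 : q (N + 1) * (e (N + 1) + C * p (N + 1)) ≤ q (N + 1) * (c * e N + C * p N) := by
        exact mul_le_mul_right (step N) _
      rw [mul_add, mul_add, ← mul_assoc (q (N + 1)) c, hqc] at h1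
      rw [Finset.sum_range_succ]
      nth_rw 2 [← hqw N]
      calc _ = (q (N + 1) * e (N + 1) + q (N + 1) * (C * p (N + 1))) +
            C * (∑ k ∈ Finset.range N, w k * p k + w N * p N) := by ring
        _ ≤ (q N * e N + q (N + 1) * (C * p N)) +
            C * (∑ k ∈ Finset.range N, w k * p k + w N * p N) := by gcongr
        _ = _ := by ring
  exact (mul_add C _ _ ▸ le_add_self).trans (le_add_self.trans (main N))

/-- The supermartingale bound for the discrete range, as a weighted sum of tail probabilities. -/
lemma IsGaussianWalk.sum_tail_le {X : ℕ → Ω → ℝ} {h : ℝ≥0} {P : Measure Ω}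
    [IsProbabilityMeasure P] (hX : IsGaussianWalk X h P) {r : ℝ} (hr : 0 < r) (N : ℕ) :
    ∑ k ∈ Finset.range N, ENNReal.ofReal (Real.exp (-(k * h)) - Real.exp (-((k + 1) * h))) *
      P {ω | r ≤ seqRange (X · ω) k} ≤ ENNReal.ofReal (1 / Real.cosh (r / √2) ^ 2) := by
  have hm : AEMeasurable (fun ω i ↦ X i ω) P := aemeasurable_pi_lambda _ hX.aemeasurable
  set C : ℝ≥0∞ := ENNReal.ofReal (Real.cosh (r / √2) ^ 2) with hC
  let u (k : ℕ) (x : ℕ → ℝ) : ℝ≥0∞ := if seqRange x k < r then 1 else 0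
  let v (k : ℕ) (x : ℕ → ℝ) : ℝ≥0∞ := if seqRange x k < r then 0 else 1
  have mu k : Measurable (u k) :=
    Measurable.ite (measurableSet_lt (measurable_seqRange k) measurable_const) (by fun_prop)
      (by fun_prop)
  have mv k : Measurable (v k) :=
    Measurable.ite (measurableSet_lt (measurable_seqRange k) measurable_const) (by fun_prop)
      (by fun_prop)
  let Z (k : ℕ) (x : ℕ → ℝ) : ℝ≥0∞ := ENNReal.ofReal (rangePotential x k)
  have mZ k : Measurable (Z k) := by fun_prop
  let p (k : ℕ) : ℝ≥0∞ := ∫⁻ ω, v k (X · ω) ∂P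
  have hp k : P {ω | r ≤ seqRange (X · ω) k} = p k := by
    have hs : NullMeasurableSet {ω | r ≤ seqRange (X · ω) k} P :=
      nullMeasurableSet_le aemeasurable_const ((measurable_seqRange k).comp_aemeasurable hm)
    rw [← lintegral_indicator_one₀ hs]
    refine lintegral_congr fun ω ↦ ?_
    by_cases h : r ≤ seqRange (X · ω) k
    · simp [v, h, not_lt.2 h]
    · simp [v, h, not_le.1 h]
  simp_rw [hp]
  let q (k : ℕ) : ℝ≥0∞ := ENNReal.ofReal (Real.exp (-(k * h)))
  let w (k : ℕ) : ℝ≥0∞ := ENNReal.ofReal (Real.exp (-(k * h)) - Real.exp (-((k + 1) * h)))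
  have hqw k : q (k + 1) + w k = q k := by
    rw [← ENNReal.ofReal_add (Real.exp_pos _).le]
    · simp [q]
    · rw [sub_nonneg, Real.exp_le_exp, neg_le_neg_iff]
      gcongr
      linarith
  have hqe k : q (k + 1) * ENNReal.ofReal (Real.exp h) = q k := by
    rw [← ENNReal.ofReal_mul (Real.exp_pos _).le, ← Real.exp_add]
    congr 3
    push_cast
    ring
  -- On paths whose range is still below `r` the potential makes one step; if the range then crosses
  -- `r`, the new potential is at least `C` and pays for the increase of `p`.
  have step k : (∫⁻ ω, u (k + 1) (X · ω) * Z (k + 1) (X · ω) ∂P) + C * p (k + 1) ≤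
      ENNReal.ofReal (Real.exp h) * (∫⁻ ω, u k (X · ω) * Z k (X · ω) ∂P) + C * p k := by
    have m1 : AEMeasurable (fun ω ↦ u k (X · ω) *
        ENNReal.ofReal (rangePotential (X · ω) (k + 1))) P :=
      ((mu k).mul (mZ (k + 1))).comp_aemeasurable hm
    have m2 : AEMeasurable (fun ω ↦ u (k + 1) (X · ω) * Z (k + 1) (X · ω)) P :=
      ((mu _).mul (mZ _)).comp_aemeasurable hm
    grw [← hX.lintegral_rangePotential_succ_le k (mu k)
      (fun x ↦ by simp only [u, seqRange_comp_min])]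
    simp only [p]
    rw [← lintegral_const_mul' _ _ ENNReal.ofReal_ne_top,
      ← lintegral_const_mul' _ _ ENNReal.ofReal_ne_top,
      ← lintegral_add_left' m2, ← lintegral_add_left' m1]
    refine lintegral_mono fun ω ↦ ?_
    have hmono := seqRange_mono (X · ω) k.le_succ
    rcases lt_or_ge (seqRange (X · ω) (k + 1)) r with h1 | h1
    · simp [u, v, Z, h1, hmono.trans_lt h1]
    · rcases lt_or_ge (seqRange (X · ω) k) r with h2 | h2
      · have := cosh_sq_le_rangePotential (X · ω) k hr.le h2 h1
        simpa [u, v, Z, C, h2, not_lt.2 h1] using ENNReal.ofReal_le_ofReal this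
      · simp [u, v, not_lt.2 h1, not_lt.2 h2]
  have h0 : (∫⁻ ω, u 0 (X · ω) * Z 0 (X · ω) ∂P) = 1 := by
    simp [u, Z, seqRange_zero, hr, rangePotential_zero]
  have hp0 : p 0 = 0 := by simp [p, v, seqRange_zero, hr]
  have hq0 : q 0 = 1 := by simp [q]
  have h1 := mul_sum_le_of_supermartingale hqw hqe step h0 hp0 hq0 N
  have hC0 : 0 < Real.cosh (r / √2) ^ 2 := by positivity
  rw [one_div, ENNReal.ofReal_inv_of_pos hC0]
  exact ENNReal.le_inv_iff_mul_le.2 (by rwa [mul_comm])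

/-- A bound over all intervals `(0, N]` passes to `(0, ∞)`. -/
lemma setLIntegral_Ioi_le_of_forall_Ioc {f : ℝ → ℝ≥0∞} {C : ℝ≥0∞}
    (hf : ∀ N : ℕ, ∫⁻ x in Set.Ioc 0 (N : ℝ), f x ≤ C) : ∫⁻ x in Set.Ioi 0, f x ≤ C := by
  have : Set.Ioi (0 : ℝ) = ⋃ N : ℕ, Set.Ioc 0 (N : ℝ) := by
    ext x
    simp only [Set.mem_Ioi, Set.mem_iUnion, Set.mem_Ioc]
    exact ⟨fun h ↦ (exists_nat_ge x).imp fun N hN ↦ ⟨h, hN⟩, fun ⟨_, h, _⟩ ↦ h⟩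
  rw [this, setLIntegral_iUnion_of_directed]
  · exact iSup_le hf
  · exact (monotone_nat_of_le_succ fun N ↦ Set.Ioc_subset_Ioc_right (by simp)).directed_le

/-- Integration by parts in `u = r/√2`: `4u sech² u` has primitive `4 (u tanh u - log cosh u)`. -/
lemma hasDerivAt_sech_sq_primitive (r : ℝ) :
    HasDerivAt (fun r ↦ 4 * (r / √2 * (Real.sinh (r / √2) / Real.cosh (r / √2)) -
      Real.log (Real.cosh (r / √2)))) (2 * r * (1 / Real.cosh (r / √2) ^ 2)) r := by
  have h0 : HasDerivAt (fun r : ℝ ↦ r / √2) (1 / √2) r := (hasDerivAt_id r).div_const _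
  have hc := (Real.cosh_pos (r / √2)).ne'
  have h1 := (h0.sinh).div h0.cosh hc
  have h2 := h0.cosh.log hc
  refine (((h0.mul h1).sub h2).const_mul 4).congr_deriv ?_
  have h3 := Real.cosh_sq (r / √2)
  have h4 : (√2 : ℝ) ^ 2 = 2 := Real.sq_sqrt zero_le_two
  simp only [Pi.div_apply]
  set c := Real.cosh (r / √2)
  set s := Real.sinh (r / √2)
  have h5 : s ^ 2 = c ^ 2 - 1 := by linarith
  field_simp
  ring_nf
  simp only [h5, h4]
  ring

lemma lintegral_mul_sech_sq_le :
    ∫⁻ r in Set.Ioi (0 : ℝ), ENNReal.ofReal (2 * r * (1 / Real.cosh (r / √2) ^ 2)) ≤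
      ENNReal.ofReal (4 * Real.log 2) := by
  refine setLIntegral_Ioi_le_of_forall_Ioc fun N ↦ ?_
  have hcont : Continuous fun r : ℝ ↦ 2 * r * (1 / Real.cosh (r / √2) ^ 2) := by
    have := Real.continuous_cosh
    have (r : ℝ) : Real.cosh (r / √2) ^ 2 ≠ 0 := (pow_pos (Real.cosh_pos _) 2).ne'
    fun_prop (disch := exact this _)
  rw [← ofReal_integral_eq_lintegral_ofReal]
  rotate_left
  · exact hcont.integrableOn_Ioc
  · refine (ae_restrict_iff' measurableSet_Ioc).2 (ae_of_all _ fun r hr ↦ ?_)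
    have := hr.1
    positivity
  apply ENNReal.ofReal_le_ofReal
  rw [← intervalIntegral.integral_of_le (Nat.cast_nonneg N),
    intervalIntegral.integral_eq_sub_of_hasDerivAt (fun r _ ↦ hasDerivAt_sech_sq_primitive r)
      (hcont.intervalIntegrable _ _)]
  simp only [zero_div, Real.cosh_zero, Real.log_one, zero_mul, sub_zero, mul_zero]
  set u := (N : ℝ) / √2
  have hu : 0 ≤ u := by positivity
  have hc := Real.cosh_pos u
  have h1 : u * (Real.sinh u / Real.cosh u) ≤ u :=
    mul_le_of_le_one_right hu ((div_le_one hc).2 (Real.sinh_lt_cosh u).le)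
  -- From `cosh u ≥ e^u / 2`; this is where `log 2` enters.
  have h2 : u - Real.log 2 ≤ Real.log (Real.cosh u) := by
    rw [Real.le_log_iff_exp_le hc, Real.exp_sub, Real.exp_log two_pos, Real.cosh_eq]
    have := Real.exp_pos (-u)
    linarith
  linarith

/-- The discounted second moment of the range of a Gaussian walk. -/
lemma IsGaussianWalk.sum_sq_le {X : ℕ → Ω → ℝ} {h : ℝ≥0} {P : Measure Ω}
    [IsProbabilityMeasure P] (hX : IsGaussianWalk X h P) (N : ℕ) :
    ∑ k ∈ Finset.range N, ENNReal.ofReal (Real.exp (-(k * h)) - Real.exp (-((k + 1) * h))) *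
      ∫⁻ ω, ENNReal.ofReal (seqRange (X · ω) k ^ 2) ∂P ≤ ENNReal.ofReal (4 * Real.log 2) := by
  have hm : AEMeasurable (fun ω i ↦ X i ω) P := aemeasurable_pi_lambda _ hX.aemeasurable
  have layer k : ∫⁻ ω, ENNReal.ofReal (seqRange (X · ω) k ^ 2) ∂P =
      ∫⁻ r in Set.Ioi (0 : ℝ), P {ω | r ≤ seqRange (X · ω) k} * ENNReal.ofReal (2 * r) := by
    have := lintegral_rpow_eq_lintegral_meas_le_mul P
      (ae_of_all _ fun ω ↦ seqRange_nonneg (X · ω) k)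
      ((measurable_seqRange k).comp_aemeasurable hm) two_pos
    simp only [Real.rpow_two] at this
    rw [this, ← lintegral_const_mul' _ _ ENNReal.ofReal_ne_top]
    refine lintegral_congr fun r ↦ ?_
    rw [mul_left_comm, ← ENNReal.ofReal_mul zero_le_two]
    norm_num
  have ma k : Measurable fun r : ℝ ↦ P {ω | r ≤ seqRange (X · ω) k} :=
    Antitone.measurable fun a b hab ↦ measure_mono fun ω hω ↦ hab.trans hω
  simp_rw [layer]
  calc _ = ∫⁻ r in Set.Ioi (0 : ℝ), (∑ k ∈ Finset.range N,
        ENNReal.ofReal (Real.exp (-(k * h)) - Real.exp (-((k + 1) * h))) *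
          P {ω | r ≤ seqRange (X · ω) k}) * ENNReal.ofReal (2 * r) := by
        simp_rw [Finset.sum_mul, mul_assoc]
        have m2 (k : ℕ) : Measurable fun r : ℝ ↦
            ENNReal.ofReal (Real.exp (-(k * h)) - Real.exp (-((k + 1) * h))) *
              (P {ω | r ≤ seqRange (X · ω) k} * ENNReal.ofReal (2 * r)) :=
          ((ma k).mul (by fun_prop)).const_mul _
        rw [lintegral_finsetSum' _ fun k _ ↦ (m2 k).aemeasurable]
        exact Finset.sum_congr rfl fun k _ ↦ (lintegral_const_mul' _ _ ENNReal.ofReal_ne_top).symm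
    _ ≤ ∫⁻ r in Set.Ioi (0 : ℝ), ENNReal.ofReal (2 * r * (1 / Real.cosh (r / √2) ^ 2)) := by
        refine setLIntegral_mono' measurableSet_Ioi fun r hr ↦ ?_
        have hr0 : 0 < r := hr
        rw [ENNReal.ofReal_mul (p := 2 * r) (by positivity), mul_comm]
        exact mul_le_mul_right (hX.sum_tail_le hr N) _
    _ ≤ _ := lintegral_mul_sech_sq_le

end Walk

/-! ### From grids to the range of real Brownian motion. -/

section RealBrownian

variable {Ω : Type*} [MeasurableSpace Ω] {P : Measure Ω} {B : ℝ≥0 → Ω → ℝ}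

lemma isGaussianWalk_of_isPreBrownianReal (hB : IsPreBrownianReal B P) (h : ℝ≥0) :
    IsGaussianWalk (fun i : ℕ ↦ B (i * h)) h P where
  aemeasurable i := hB.aemeasurable _
  indep k := by
    have m1 : Measurable fun x : ℝ≥0 → ℝ ↦ x h := measurable_pi_apply h
    have m2 : Measurable fun (x : Set.Iic ((k : ℝ≥0) * h) → ℝ) (i : ℕ) ↦
        x ⟨(min i k : ℕ) * h, by simp only [Set.mem_Iic]; gcongr; exact min_le_right _ _⟩ :=
      measurable_pi_lambda _ fun i ↦ measurable_pi_apply _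
    have := (hB.indepFun_shift (k * h)).comp m1 m2
    convert this using 1
    · funext ω
      simp only [Function.comp_apply, Pi.sub_apply, Nat.cast_add, Nat.cast_one, add_mul, one_mul]
    · rfl
  law k := by
    have := hB.hasLaw_sub ((k + 1 : ℕ) * h) (k * h)
    convert this using 2
    refine NNReal.coe_injective ?_
    change (h : ℝ) = dist (((k + 1 : ℕ) * h : ℝ≥0) : ℝ) ((k * h : ℝ≥0) : ℝ)
    rw [Real.dist_eq]
    simp [add_mul]

lemma setLIntegral_Ico_eq_sum (f : ℝ → ℝ≥0∞) {h : ℝ} (hh : 0 ≤ h) (K : ℕ) :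
    ∫⁻ t in Set.Ico 0 (K * h), f t =
      ∑ k ∈ Finset.range K, ∫⁻ t in Set.Ico (k * h) ((k + 1) * h), f t := by
  induction K with
  | zero => simp
  | succ K ih =>
    rw [Finset.sum_range_succ, ← ih, ← lintegral_union measurableSet_Ico, Set.Ico_union_Ico_eq_Ico]
    · simp
    · positivity
    · gcongr; simp
    · exact Set.Ico_disjoint_Ico_same

lemma setLIntegral_exp_neg {a b : ℝ} (hab : a ≤ b) :
    ∫⁻ t in Set.Ico a b, ENNReal.ofReal (Real.exp (-t)) =
      ENNReal.ofReal (Real.exp (-a) - Real.exp (-b)) := by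
  rw [restrict_Ico_eq_restrict_Ioc, ← ofReal_integral_eq_lintegral_ofReal,
    ← intervalIntegral.integral_of_le hab]
  · congr 1
    rw [intervalIntegral.integral_comp_neg (fun t ↦ Real.exp t), integral_exp]
  · exact Continuous.integrableOn_Ioc (by fun_prop)
  · exact ae_of_all _ fun t ↦ (Real.exp_pos _).le

lemma nat_floor_div_eq {h t : ℝ} (hh : 0 < h) {k : ℕ} (ht : t ∈ Set.Ico (k * h) ((k + 1) * h)) :
    ⌊t / h⌋₊ = k := by
  have ht0 : 0 ≤ t := le_trans (by positivity) ht.1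
  rw [Nat.floor_eq_iff (by positivity), le_div_iff₀ hh, div_lt_iff₀ hh]
  exact ht

/-- The discounted second moment of the range of Brownian motion along a grid of mesh `h`. -/
lemma lintegral_exp_mul_sq_seqRange_le [IsProbabilityMeasure P] (hB : IsPreBrownianReal B P)
    {h : ℝ≥0} (hh : 0 < h) :
    ∫⁻ t in Set.Ioi (0 : ℝ), ENNReal.ofReal (Real.exp (-t)) *
      ∫⁻ ω, ENNReal.ofReal (seqRange (fun i : ℕ ↦ B (i * h) ω) ⌊t / h⌋₊ ^ 2) ∂P ≤
      ENNReal.ofReal (4 * Real.log 2) := by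
  have hh' : (0 : ℝ) < h := hh
  refine setLIntegral_Ioi_le_of_forall_Ioc fun N ↦ ?_
  obtain ⟨K, hK⟩ := exists_nat_gt (N / (h : ℝ))
  rw [div_lt_iff₀ hh'] at hK
  refine (lintegral_mono_set (t := Set.Ico 0 (K * (h : ℝ)))
    fun x hx ↦ ⟨hx.1.le, hx.2.trans_lt hK⟩).trans ?_
  rw [setLIntegral_Ico_eq_sum _ hh'.le]
  refine le_trans (Finset.sum_le_sum fun k _ ↦ ?_)
    ((isGaussianWalk_of_isPreBrownianReal hB h).sum_sq_le K)
  -- On each block of length `h` the grid index is constant, and `e^{-t}` integrates to the weight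
  -- in `IsGaussianWalk.sum_sq_le`.
  rw [← setLIntegral_exp_neg (by gcongr; simp), ← lintegral_mul_const _ (by fun_prop)]
  refine (setLIntegral_congr_fun measurableSet_Ico fun t ht ↦ ?_).le
  simp only [nat_floor_div_eq hh' ht]

lemma tendsto_floor_mul (s : ℝ≥0) :
    Filter.Tendsto
      (fun m : ℕ ↦ (⌊(s : ℝ) / ((1 / (m + 1) : ℝ≥0) : ℝ)⌋₊ : ℝ≥0) * (1 / (m + 1) : ℝ≥0))
      Filter.atTop (nhds s) := by
  have h0 : Filter.Tendsto (fun m : ℕ ↦ (1 / (m + 1) : ℝ)) Filter.atTop (nhds 0) :=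
    tendsto_one_div_add_atTop_nhds_zero_nat
  rw [← NNReal.tendsto_coe]
  have h1 : Filter.Tendsto (fun m : ℕ ↦ (s : ℝ) - (1 / (m + 1) : ℝ)) Filter.atTop (nhds s) := by
    simpa using h0.const_sub (s : ℝ)
  refine tendsto_of_tendsto_of_tendsto_of_le_of_le h1 tendsto_const_nhds (fun m ↦ ?_) (fun m ↦ ?_)
  · have := Nat.lt_floor_add_one ((s : ℝ) / ((1 / (m + 1) : ℝ≥0) : ℝ))
    push_cast at this ⊢
    have hm : (0 : ℝ) < 1 / (m + 1) := by positivity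
    rw [div_lt_iff₀ hm] at this
    linarith
  · have hm : (0 : ℝ) < 1 / (m + 1) := by positivity
    have := Nat.floor_le (a := (s : ℝ) / ((1 / (m + 1) : ℝ≥0) : ℝ)) (by positivity)
    push_cast at this ⊢
    rwa [le_div_iff₀ hm] at this

lemma ediam_sq_le {α : Type*} [PseudoEMetricSpace α] {s : Set α} {L : ℝ≥0∞}
    (h : ∀ x ∈ s, ∀ y ∈ s, edist x y ^ 2 ≤ L) : Metric.ediam s ^ 2 ≤ L := by
  have : Metric.ediam s ≤ L ^ (1 / 2 : ℝ) := by
    refine Metric.ediam_le fun x hx y hy ↦ ?_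
    rw [one_div, ENNReal.le_rpow_inv_iff two_pos]
    exact_mod_cast h x hx y hy
  rw [one_div, ENNReal.le_rpow_inv_iff two_pos] at this
  exact_mod_cast this

/-- Along finer and finer grids the range of a continuous path is recovered. -/
lemma ediam_sq_le_liminf {w : ℝ≥0 → ℝ} (hw : Continuous w) (t : ℝ) :
    Metric.ediam (w '' Set.Icc 0 t.toNNReal) ^ 2 ≤
      Filter.liminf (fun m : ℕ ↦ ENNReal.ofReal
        (seqRange (fun i : ℕ ↦ w (i * (1 / (m + 1) : ℝ≥0))) ⌊t / ((1 / (m + 1) : ℝ≥0) : ℝ)⌋₊ ^ 2))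
        Filter.atTop := by
  refine ediam_sq_le ?_
  rintro _ ⟨s, hs, rfl⟩ _ ⟨s', hs', rfl⟩
  -- For a fixed pair of times, rounding down to the grid gives two grid values whose distance tends
  -- to that of the path values; no uniformity over pairs is needed.
  have hlim (s : ℝ≥0) := (hw.tendsto s).comp (tendsto_floor_mul s)
  have h2 := ((ENNReal.continuous_pow 2).tendsto _).comp ((hlim s).edist (hlim s'))
  rw [← h2.liminf_eq]
  refine Filter.liminf_le_liminf (Filter.Eventually.of_forall fun m ↦ ?_)
  simp only [Function.comp_apply]
  rw [edist_dist, ← ENNReal.ofReal_pow dist_nonneg, Real.dist_eq]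
  gcongr
  have hle {s : ℝ≥0} (hs : s ∈ Set.Icc 0 t.toNNReal) :
      ⌊(s : ℝ) / ((1 / (m + 1) : ℝ≥0) : ℝ)⌋₊ ≤ ⌊t / ((1 / (m + 1) : ℝ≥0) : ℝ)⌋₊ := by
    rcases le_total t 0 with ht | ht
    · have : s = 0 := by simpa [Real.toNNReal_of_nonpos ht] using hs.2
      simp [this]
    · have : (s : ℝ) ≤ t := by
        have := NNReal.coe_le_coe.2 hs.2
        rwa [Real.coe_toNNReal _ ht] at this
      gcongr
  exact abs_sub_le_seqRange (fun i : ℕ ↦ w (i * (1 / (m + 1) : ℝ≥0))) (hle hs) (hle hs')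

/-- The discounted second moment of the range of a Brownian motion. -/
lemma lintegral_exp_mul_sq_ediam_le [IsProbabilityMeasure P] (hB : IsBrownianReal B P) :
    ∫⁻ t in Set.Ioi (0 : ℝ), ENNReal.ofReal (Real.exp (-t)) *
      ∫⁻ ω, Metric.ediam ((B · ω) '' Set.Icc 0 t.toNNReal) ^ 2 ∂P ≤
      ENNReal.ofReal (4 * Real.log 2) := by
  let F (m : ℕ) (t : ℝ) : ℝ≥0∞ := ∫⁻ ω, ENNReal.ofReal
    (seqRange (fun i : ℕ ↦ B (i * (1 / (m + 1) : ℝ≥0)) ω) ⌊t / ((1 / (m + 1) : ℝ≥0) : ℝ)⌋₊ ^ 2) ∂P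
  have hF m : Measurable (F m) := by
    refine Monotone.measurable fun a b hab ↦ lintegral_mono fun ω ↦ ?_
    have := seqRange_nonneg (fun i : ℕ ↦ B (i * (1 / (m + 1) : ℝ≥0)) ω)
    dsimp only
    gcongr
    · exact this _
    · refine seqRange_mono _ ?_
      gcongr
  -- Fatou is applied twice: here over the sample space, and below over time.
  have h1 (t : ℝ) : ∫⁻ ω, Metric.ediam ((B · ω) '' Set.Icc 0 t.toNNReal) ^ 2 ∂P ≤
      Filter.liminf (fun m ↦ F m t) Filter.atTop := by
    refine (lintegral_mono_ae ?_).trans (lintegral_liminf_le' fun m ↦ ?_)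
    · filter_upwards [hB.cont] with ω hω
      exact ediam_sq_le_liminf hω t
    · have hm := fun i : ℕ ↦ hB.aemeasurable (i * (1 / (m + 1) : ℝ≥0))
      have := (measurable_seqRange ⌊t / ((1 / (m + 1) : ℝ≥0) : ℝ)⌋₊).comp_aemeasurable
        (aemeasurable_pi_lambda _ hm)
      exact (this.pow_const 2).ennreal_ofReal
  calc _ ≤ ∫⁻ t in Set.Ioi (0 : ℝ), Filter.liminf
        (fun m ↦ ENNReal.ofReal (Real.exp (-t)) * F m t) Filter.atTop := by
        refine lintegral_mono fun t ↦ ?_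
        rw [ENNReal.liminf_const_mul_of_ne_top ENNReal.ofReal_ne_top]
        gcongr
        exact h1 t
    _ ≤ Filter.liminf (fun m ↦ ∫⁻ t in Set.Ioi (0 : ℝ), ENNReal.ofReal (Real.exp (-t)) * F m t)
        Filter.atTop := lintegral_liminf_le fun m ↦ by fun_prop
    _ ≤ Filter.liminf (fun _ : ℕ ↦ ENNReal.ofReal (4 * Real.log 2)) Filter.atTop := by
        refine Filter.liminf_le_liminf (Filter.Eventually.of_forall fun m ↦ ?_)
        exact lintegral_exp_mul_sq_seqRange_le hB.toIsPreBrownianReal (by positivity)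
    _ = _ := Filter.liminf_const _

end RealBrownian

/-- Layer cake for extended nonnegative functions. -/
lemma lintegral_eq_lintegral_meas_ofReal_le {α : Type*} [MeasurableSpace α] {μ : Measure α}
    [SFinite μ] {f : α → ℝ≥0∞} (hf : AEMeasurable f μ) :
    ∫⁻ a, f a ∂μ = ∫⁻ t in Set.Ioi (0 : ℝ), μ {a | ENNReal.ofReal t ≤ f a} := by
  wlog hm : Measurable f generalizing f
  · rw [lintegral_congr_ae hf.ae_eq_mk, this hf.measurable_mk.aemeasurable hf.measurable_mk]
    refine lintegral_congr fun t ↦ measure_congr ?_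
    filter_upwards [hf.ae_eq_mk] with a ha
    exact congrArg (ENNReal.ofReal t ≤ ·) ha.symm
  have hs : MeasurableSet {p : α × ℝ | ENNReal.ofReal p.2 ≤ f p.1} :=
    measurableSet_le (by fun_prop) (by fun_prop)
  have h1 (x : ℝ≥0∞) : ∫⁻ t in Set.Ioi (0 : ℝ),
      {t : ℝ | ENNReal.ofReal t ≤ x}.indicator 1 t = x := by
    have hst : MeasurableSet {t : ℝ | ENNReal.ofReal t ≤ x} :=
      measurableSet_le (by fun_prop) (by fun_prop)
    rw [lintegral_indicator_one hst, Measure.restrict_apply hst]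
    induction x with
    | top => simp
    | coe x =>
      have : {t : ℝ | ENNReal.ofReal t ≤ x} ∩ Set.Ioi 0 = Set.Ioc 0 (x : ℝ) := by
        ext t
        simp [ENNReal.ofReal, Real.toNNReal_le_iff_le_coe, and_comm]
      rw [this]
      simp
  calc _ = ∫⁻ a, (∫⁻ t in Set.Ioi (0 : ℝ), {t : ℝ | ENNReal.ofReal t ≤ f a}.indicator 1 t) ∂μ := by
        simp_rw [h1]
    _ = ∫⁻ t in Set.Ioi (0 : ℝ), ∫⁻ a, {t : ℝ | ENNReal.ofReal t ≤ f a}.indicator 1 t ∂μ :=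
        lintegral_lintegral_swap (f := fun a t ↦ {t : ℝ | ENNReal.ofReal t ≤ f a}.indicator 1 t)
          (measurable_one.indicator hs).aemeasurable
    _ = _ := by
        refine lintegral_congr fun t ↦ ?_
        rw [← lintegral_indicator_one (measurableSet_le (by fun_prop) hm)]
        rfl

/-! ### The hull diameter of a single path. -/

section Path

variable {n : ℕ} {w : ℝ≥0 → EuclideanSpace ℝ (Fin n)}

lemma hullDiameter_eq_ediam (w : ℝ≥0 → EuclideanSpace ℝ (Fin n)) (t : ℝ≥0) :
    hullDiameter w t = Metric.ediam (w '' Set.Icc 0 t) := convexHull_ediam _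

lemma hullDiameter_mono (w : ℝ≥0 → EuclideanSpace ℝ (Fin n)) : Monotone (hullDiameter w) := by
  intro s t hst
  rw [hullDiameter_eq_ediam, hullDiameter_eq_ediam]
  exact Metric.ediam_mono (Set.image_mono (Set.Icc_subset_Icc_right hst))

lemma edist_le_hullDiameter (w : ℝ≥0 → EuclideanSpace ℝ (Fin n)) {s s' t : ℝ≥0} (hs : s ≤ t)
    (hs' : s' ≤ t) : edist (w s) (w s') ≤ hullDiameter w t := by
  rw [hullDiameter_eq_ediam]
  exact Metric.edist_le_ediam_of_mem ⟨s, ⟨zero_le, hs⟩, rfl⟩ ⟨s', ⟨zero_le, hs'⟩, rfl⟩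

/-- Pythagoras for each pair of points, each coordinate difference being at most the range of that
coordinate. -/
lemma hullDiameter_sq_le_sum (w : ℝ≥0 → EuclideanSpace ℝ (Fin n)) (t : ℝ≥0) :
    hullDiameter w t ^ 2 ≤ ∑ j, Metric.ediam ((fun s ↦ w s j) '' Set.Icc 0 t) ^ 2 := by
  rw [hullDiameter_eq_ediam]
  refine ediam_sq_le ?_
  rintro _ ⟨s, hs, rfl⟩ _ ⟨s', hs', rfl⟩
  rw [EuclideanSpace.edist_eq, ← ENNReal.rpow_natCast, ← ENNReal.rpow_mul]
  norm_num
  gcongr with j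
  exact Metric.edist_le_ediam_of_mem (Set.mem_image_of_mem _ hs) (Set.mem_image_of_mem _ hs')

/-- A fixed countable dense subset of the unit time interval. -/
noncomputable def denseTimes : Set (Set.Icc (0 : ℝ≥0) 1) :=
  (TopologicalSpace.exists_countable_dense (Set.Icc (0 : ℝ≥0) 1)).choose

lemma denseTimes_countable : denseTimes.Countable :=
  (TopologicalSpace.exists_countable_dense (Set.Icc (0 : ℝ≥0) 1)).choose_spec.1

lemma denseTimes_dense : Dense denseTimes :=
  (TopologicalSpace.exists_countable_dense (Set.Icc (0 : ℝ≥0) 1)).choose_spec.2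

instance : Countable denseTimes := denseTimes_countable.to_subtype

/-- The diameter of a family of points indexed by the dense times, in coordinates. -/
noncomputable def denseDiameter (x : Fin n → denseTimes → ℝ) : ℝ≥0∞ :=
  ⨆ p : denseTimes × denseTimes,
    edist (WithLp.toLp 2 fun j ↦ x j p.1 : EuclideanSpace ℝ (Fin n)) (WithLp.toLp 2 fun j ↦ x j p.2)

@[fun_prop]
lemma measurable_denseDiameter : Measurable (denseDiameter (n := n)) := by
  refine Measurable.iSup fun p ↦ ?_
  fun_prop

/-- Parametrising `[0, t]` by `t * u` makes the index set independent of `t`: the countable supremum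
gives measurability, and paths at different scales can be compared. -/
lemma ediam_image_Icc_eq_iSup {α : Type*} [PseudoEMetricSpace α] {w : ℝ≥0 → α}
    (hw : Continuous w) (t : ℝ≥0) :
    Metric.ediam (w '' Set.Icc 0 t) =
      ⨆ p : denseTimes × denseTimes, edist (w (t * p.1)) (w (t * p.2)) := by
  have himg : w '' Set.Icc 0 t = Set.range fun u : Set.Icc (0 : ℝ≥0) 1 ↦ w (t * u) := by
    ext y
    simp only [Set.mem_image, Set.mem_range, Subtype.exists, exists_prop, Set.mem_Icc, zero_le,
      true_and]
    constructor
    · rintro ⟨s, hs, rfl⟩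
      rcases eq_or_ne t 0 with rfl | ht
      · exact ⟨0, zero_le, by simp [nonpos_iff_eq_zero.1 hs]⟩
      · exact ⟨s / t, div_le_one_of_le₀ hs zero_le, by rw [mul_div_cancel₀ _ ht]⟩
    · rintro ⟨u, hu, rfl⟩
      exact ⟨t * u, mul_le_of_le_one_right zero_le hu, rfl⟩
  have hc : Continuous fun u : Set.Icc (0 : ℝ≥0) 1 ↦ w (t * u) := by fun_prop
  rw [himg]
  refine le_antisymm ?_ ?_
  · refine (Metric.ediam_mono (hc.range_subset_closure_image_dense denseTimes_dense)).trans ?_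
    rw [Metric.ediam_closure]
    refine Metric.ediam_le ?_
    rintro _ ⟨u, hu, rfl⟩ _ ⟨v, hv, rfl⟩
    exact le_iSup (fun p : denseTimes × denseTimes ↦ edist (w (t * p.1)) (w (t * p.2)))
      (⟨u, hu⟩, ⟨v, hv⟩)
  · exact iSup_le fun p ↦ Metric.edist_le_ediam_of_mem ⟨p.1, rfl⟩ ⟨p.2, rfl⟩

lemma hullDiameter_eq_denseDiameter (hw : Continuous w) (t : ℝ≥0) :
    hullDiameter w t = denseDiameter fun j q ↦ w (t * q) j := by
  rw [hullDiameter_eq_ediam, ediam_image_Icc_eq_iSup hw]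
  rfl

lemma denseDiameter_mul (c : ℝ≥0) (x : Fin n → denseTimes → ℝ) :
    denseDiameter (fun j q ↦ c * x j q) = c * denseDiameter x := by
  rw [denseDiameter, denseDiameter, ENNReal.mul_iSup]
  refine iSup_congr fun p ↦ ?_
  have := edist_smul₀ (c : ℝ) (WithLp.toLp 2 fun j ↦ x j p.1 : EuclideanSpace ℝ (Fin n))
    (WithLp.toLp 2 fun j ↦ x j p.2)
  refine (Eq.trans ?_ this).trans ?_
  · rfl
  · simp [ENNReal.smul_def]

end Path

/-! ### Brownian scaling. -/

section Brownian

variable {Ω : Type*} [MeasurableSpace Ω] {P : Measure Ω} {n : ℕ}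
  {W : ℝ≥0 → Ω → EuclideanSpace ℝ (Fin n)}

lemma IsBrownianMotion.continuous (hW : IsBrownianMotion W P) :
    ∀ᵐ ω ∂P, Continuous fun t ↦ W t ω := by
  filter_upwards [ae_all_iff.2 fun j ↦ (hW.coord j).cont] with ω hω
  exact (PiLp.continuous_toLp 2 _).comp (continuous_pi hω)

lemma IsBrownianMotion.aemeasurable_dense (hW : IsBrownianMotion W P) (t : ℝ≥0) :
    AEMeasurable (fun ω (j : Fin n) (q : denseTimes) ↦ W (t * q) ω j) P :=
  aemeasurable_pi_lambda _ fun j ↦ aemeasurable_pi_lambda _ fun _ ↦ (hW.coord j).aemeasurable _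

lemma IsBrownianMotion.hullDiameter_ae_eq (hW : IsBrownianMotion W P) (t : ℝ≥0) :
    (fun ω ↦ hullDiameter (fun s ↦ W s ω) t) =ᵐ[P]
      fun ω ↦ denseDiameter fun j q ↦ W (t * q) ω j := by
  filter_upwards [hW.continuous] with ω hω
  exact hullDiameter_eq_denseDiameter hω t

lemma IsBrownianMotion.aemeasurable_hullDiameter (hW : IsBrownianMotion W P) (t : ℝ≥0) :
    AEMeasurable (fun ω ↦ hullDiameter (fun s ↦ W s ω) t) P :=
  (measurable_denseDiameter.comp_aemeasurable (hW.aemeasurable_dense t)).congr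
    (hW.hullDiameter_ae_eq t).symm

/-- Brownian scaling on the dense times. -/
lemma IsBrownianMotion.map_scaling [IsProbabilityMeasure P] (hW : IsBrownianMotion W P) {t : ℝ≥0}
    (ht : t ≠ 0) :
    P.map (fun ω (j : Fin n) (q : denseTimes) ↦ (√t)⁻¹ * W (t * q) ω j) =
      P.map (fun ω (j : Fin n) (q : denseTimes) ↦ W q ω j) := by
  have m1 (j : Fin n) : AEMeasurable (fun ω (q : denseTimes) ↦ (√t)⁻¹ * W (t * q) ω j) P :=
    aemeasurable_pi_lambda _ fun q ↦ ((hW.coord j).aemeasurable _).const_mul _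
  have m2 (j : Fin n) : AEMeasurable (fun ω (q : denseTimes) ↦ W q ω j) P :=
    aemeasurable_pi_lambda _ fun _ ↦ (hW.coord j).aemeasurable _
  have me (s : ℝ≥0) : Measurable fun x : ℝ≥0 → ℝ ↦ x s := measurable_pi_apply s
  have i1 : iIndepFun (fun (j : Fin n) ω (q : denseTimes) ↦ (√t)⁻¹ * W (t * q) ω j) P :=
    hW.indep.comp (fun _ x (q : denseTimes) ↦ (√t)⁻¹ * x (t * q))
      fun j ↦ measurable_pi_lambda _ fun q ↦ (me _).const_mul _
  have i2 : iIndepFun (fun (j : Fin n) ω (q : denseTimes) ↦ W q ω j) P :=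
    hW.indep.comp (fun _ x (q : denseTimes) ↦ x q) fun _ ↦ measurable_pi_lambda _ fun _ ↦ me _
  -- Independence reduces equality of laws to single coordinates, and there finite-dimensional
  -- distributions suffice.
  rw [(iIndepFun_iff_map_fun_eq_pi_map m1).1 i1, (iIndepFun_iff_map_fun_eq_pi_map m2).1 i2]
  congr 1
  funext j
  rw [map_eq_iff_forall_finset_map_restrict_eq (m1 j) (m2 j)]
  intro I
  have hinj : Function.Injective fun q : denseTimes ↦ (q : ℝ≥0) :=
    Subtype.val_injective.comp Subtype.val_injective
  let J : Finset ℝ≥0 := I.map ⟨_, hinj⟩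
  let φ (x : J → ℝ) (q : I) : ℝ := x ⟨q.1, Finset.mem_map_of_mem _ q.2⟩
  have mφ : Measurable φ := measurable_pi_lambda _ fun q ↦ measurable_pi_apply _
  have l1 := ((hW.coord j).smul ht).hasLaw J
  have l2 := (hW.coord j).hasLaw J
  have e1 := congrArg (Measure.map φ) (l1.map_eq.trans l2.map_eq.symm)
  rw [AEMeasurable.map_map_of_aemeasurable mφ.aemeasurable l1.aemeasurable,
    AEMeasurable.map_map_of_aemeasurable mφ.aemeasurable l2.aemeasurable] at e1
  exact e1

/-- Brownian scaling of the hull diameter. -/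
lemma IsBrownianMotion.map_hullDiameter [IsProbabilityMeasure P] (hW : IsBrownianMotion W P)
    (t : ℝ≥0) (ht : t ≠ 0) :
    P.map (fun ω ↦ hullDiameter (fun s ↦ W s ω) t) =
      P.map (fun ω ↦ (NNReal.sqrt t : ℝ≥0∞) * hullDiameter (fun s ↦ W s ω) 1) := by
  have h1 := hW.hullDiameter_ae_eq 1
  simp only [one_mul] at h1
  have hs : (√(t : ℝ)) ≠ 0 := (Real.sqrt_pos.2 (by positivity)).ne'
  have e1 : (fun ω ↦ hullDiameter (fun s ↦ W s ω) t) =ᵐ[P]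
      (fun x : Fin n → denseTimes → ℝ ↦ (NNReal.sqrt t : ℝ≥0∞) * denseDiameter x) ∘
        fun ω j q ↦ (√t)⁻¹ * W (t * q) ω j := by
    filter_upwards [hW.hullDiameter_ae_eq t] with ω hω
    rw [hω, Function.comp_apply, ← denseDiameter_mul]
    congr with j q
    simp [hs]
  have e2 : (fun ω ↦ (NNReal.sqrt t : ℝ≥0∞) * hullDiameter (fun s ↦ W s ω) 1) =ᵐ[P]
      (fun x : Fin n → denseTimes → ℝ ↦ (NNReal.sqrt t : ℝ≥0∞) * denseDiameter x) ∘
        fun ω j q ↦ W q ω j := by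
    filter_upwards [h1] with ω hω
    rw [hω]
    rfl
  have mF : Measurable fun x : Fin n → denseTimes → ℝ ↦
      (NNReal.sqrt t : ℝ≥0∞) * denseDiameter x := by
    fun_prop
  have m1 : AEMeasurable (fun ω (j : Fin n) (q : denseTimes) ↦ (√t)⁻¹ * W (t * q) ω j) P :=
    aemeasurable_pi_lambda _ fun j ↦ aemeasurable_pi_lambda _ fun q ↦
      ((hW.coord j).aemeasurable _).const_mul _
  have m2 : AEMeasurable (fun ω (j : Fin n) (q : denseTimes) ↦ W q ω j) P :=
    aemeasurable_pi_lambda _ fun j ↦ aemeasurable_pi_lambda _ fun _ ↦ (hW.coord j).aemeasurable _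
  rw [Measure.map_congr e1, Measure.map_congr e2,
    ← AEMeasurable.map_map_of_aemeasurable mF.aemeasurable m1,
    ← AEMeasurable.map_map_of_aemeasurable mF.aemeasurable m2, hW.map_scaling ht]

end Brownian

/-! ### Second moment of the diameter and the lower bound. -/

section LowerBound

lemma aemeasurable_ediam_image_Icc {Ω : Type*} [MeasurableSpace Ω] {P : Measure Ω}
    {B : ℝ≥0 → Ω → ℝ} (hB : IsBrownianReal B P) (t : ℝ≥0) :
    AEMeasurable (fun ω ↦ Metric.ediam ((B · ω) '' Set.Icc 0 t)) P := by
  have hm := hB.aemeasurable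
  have : AEMeasurable (fun ω ↦ ⨆ p : denseTimes × denseTimes,
      edist (B (t * p.1) ω) (B (t * p.2) ω)) P :=
    AEMeasurable.iSup fun p ↦ (hm _).edist (hm _)
  refine this.congr ?_
  filter_upwards [hB.cont] with ω hω
  exact (ediam_image_Icc_eq_iSup hω t).symm

lemma le_inverseProcess {X : ℝ≥0 → ℝ≥0∞} (hX : Monotone X) {y t : ℝ≥0} (h : X t ≤ y) :
    (t : ℝ≥0∞) ≤ inverseProcess X y := by
  refine le_sInf ?_
  rintro _ ⟨s, rfl, hs⟩
  by_contra! hst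
  exact (h.trans_lt hs).not_ge (hX (by exact_mod_cast hst.le))

lemma le_of_lt_inverseProcess {X : ℝ≥0 → ℝ≥0∞} {y t : ℝ≥0}
    (h : (t : ℝ≥0∞) < inverseProcess X y) : X t ≤ y := by
  by_contra! ht
  exact h.not_ge (sInf_le ⟨t, rfl, ht⟩)

/-- Monotonicity of `X` allows times from a dense set only; with a countable one, `Θ` becomes a
countable infimum of measurable functions. -/
lemma inverseProcess_eq_iInf {X : ℝ≥0 → ℝ≥0∞} (hX : Monotone X) {S : Set ℝ≥0} (hS : Dense S)
    (y : ℝ≥0) : inverseProcess X y = ⨅ q : S, if (y : ℝ≥0∞) < X q then (q : ℝ≥0∞) else ⊤ := by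
  refine le_antisymm (le_iInf fun q ↦ ?_) (le_sInf ?_)
  · split_ifs with h
    · exact sInf_le ⟨q, rfl, h⟩
    · exact le_top
  · rintro _ ⟨t, rfl, ht⟩
    refine le_of_forall_gt fun c hc ↦ ?_
    obtain ⟨c', h1, h2⟩ := ENNReal.lt_iff_exists_nnreal_btwn.1 hc
    obtain ⟨q, hq, h3, h4⟩ := hS.exists_between (ENNReal.coe_lt_coe.1 h1)
    refine ((iInf_le _ ⟨q, hq⟩).trans ?_).trans_lt h2
    rw [if_pos (ht.trans_le (hX h3.le))]
    exact_mod_cast h4.le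

variable {Ω : Type*} [MeasurableSpace Ω] {P : Measure Ω} {n : ℕ}
  {W : ℝ≥0 → Ω → EuclideanSpace ℝ (Fin n)}

lemma IsBrownianMotion.aemeasurable_inverseDiameterTime (hW : IsBrownianMotion W P) (y : ℝ≥0) :
    AEMeasurable (inverseDiameterTime W y) P := by
  obtain ⟨S, hSc, hSd⟩ := TopologicalSpace.exists_countable_dense ℝ≥0
  have := hSc.to_subtype
  have h : inverseDiameterTime W y = fun ω ↦ ⨅ q : S,
      if (y : ℝ≥0∞) < hullDiameter (fun s ↦ W s ω) q then ((q : ℝ≥0) : ℝ≥0∞) else ⊤ :=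
    funext fun ω ↦ inverseProcess_eq_iInf (hullDiameter_mono _) hSd y
  rw [h]
  refine AEMeasurable.iInf fun q ↦ ?_
  have hm : Measurable fun d : ℝ≥0∞ ↦ if (y : ℝ≥0∞) < d then ((q : ℝ≥0) : ℝ≥0∞) else ⊤ :=
    Measurable.ite measurableSet_Ioi measurable_const measurable_const
  exact hm.comp_aemeasurable (hW.aemeasurable_hullDiameter q)

lemma IsBrownianMotion.lintegral_exp_mul_sq_hullDiameter_le [IsProbabilityMeasure P]
    (hW : IsBrownianMotion W P) :
    ∫⁻ t in Set.Ioi (0 : ℝ), ENNReal.ofReal (Real.exp (-t)) *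
      ∫⁻ ω, hullDiameter (fun s ↦ W s ω) t.toNNReal ^ 2 ∂P ≤
      ENNReal.ofReal (4 * n * Real.log 2) := by
  have hm (j : Fin n) : Measurable fun t : ℝ ↦ ENNReal.ofReal (Real.exp (-t)) *
      ∫⁻ ω, Metric.ediam ((fun s ↦ W s ω j) '' Set.Icc 0 t.toNNReal) ^ 2 ∂P := by
    refine Measurable.mul (by fun_prop) (Monotone.measurable fun a b hab ↦
      lintegral_mono fun ω ↦ ?_)
    dsimp only
    gcongr
  calc _ ≤ ∫⁻ t in Set.Ioi (0 : ℝ), ∑ j : Fin n, ENNReal.ofReal (Real.exp (-t)) *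
        ∫⁻ ω, Metric.ediam ((fun s ↦ W s ω j) '' Set.Icc 0 t.toNNReal) ^ 2 ∂P := by
        refine lintegral_mono fun t ↦ ?_
        rw [← Finset.mul_sum, ← lintegral_finsetSum' _ fun j _ ↦
          (aemeasurable_ediam_image_Icc (hW.coord j) t.toNNReal).pow_const 2]
        gcongr with ω
        exact hullDiameter_sq_le_sum (fun s ↦ W s ω) t.toNNReal
    _ = ∑ j : Fin n, ∫⁻ t in Set.Ioi (0 : ℝ), ENNReal.ofReal (Real.exp (-t)) *
        ∫⁻ ω, Metric.ediam ((fun s ↦ W s ω j) '' Set.Icc 0 t.toNNReal) ^ 2 ∂P :=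
        lintegral_finsetSum' _ fun j _ ↦ (hm j).aemeasurable
    _ ≤ ∑ _j : Fin n, ENNReal.ofReal (4 * Real.log 2) :=
        Finset.sum_le_sum fun j _ ↦ lintegral_exp_mul_sq_ediam_le (hW.coord j)
    _ = _ := by
        rw [Finset.sum_const, Finset.card_univ, Fintype.card_fin, nsmul_eq_mul,
          ← ENNReal.ofReal_natCast, ← ENNReal.ofReal_mul (by positivity)]
        congr 1
        ring

lemma lintegral_exp_neg_mul_self :
    ∫⁻ t in Set.Ioi (0 : ℝ), ENNReal.ofReal (Real.exp (-t)) * ENNReal.ofReal t = 1 := by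
  have h1 := Real.GammaIntegral_convergent two_pos
  have h2 := Real.Gamma_eq_integral two_pos
  have e : (2 : ℝ) - 1 = 1 := by norm_num
  simp only [e, Real.rpow_one, Real.Gamma_two] at h1 h2
  have h3 := ofReal_integral_eq_lintegral_ofReal h1
    ((ae_restrict_iff' measurableSet_Ioi).2 (ae_of_all _ fun t ht ↦
      mul_nonneg (Real.exp_pos _).le (le_of_lt ht)))
  rw [← h2, ENNReal.ofReal_one] at h3
  rw [h3]
  exact lintegral_congr fun t ↦ (ENNReal.ofReal_mul (Real.exp_pos _).le).symm

/-- The second moment of the hull diameter at time one. -/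
lemma IsBrownianMotion.lintegral_sq_hullDiameter_le [IsProbabilityMeasure P]
    (hW : IsBrownianMotion W P) :
    ∫⁻ ω, hullDiameter (fun s ↦ W s ω) 1 ^ 2 ∂P ≤ ENNReal.ofReal (4 * n * Real.log 2) := by
  refine le_trans (le_of_eq ?_) hW.lintegral_exp_mul_sq_hullDiameter_le
  -- Write `1 = ∫ t e^{-t} dt` and absorb the factor `t` into the diameter by scaling.
  rw [← one_mul (lintegral _ _), ← lintegral_exp_neg_mul_self,
    ← lintegral_mul_const _ (by fun_prop)]
  refine setLIntegral_congr_fun measurableSet_Ioi fun t ht ↦ ?_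
  have ht0 : 0 < t := ht
  rw [mul_assoc]
  congr 1
  have m1 := hW.aemeasurable_hullDiameter 1
  have mt := hW.aemeasurable_hullDiameter t.toNNReal
  have hsq : Measurable fun x : ℝ≥0∞ ↦ x ^ 2 := by fun_prop
  have := hW.map_hullDiameter t.toNNReal (Real.toNNReal_pos.2 ht0).ne'
  rw [← lintegral_map' hsq.aemeasurable mt, this, lintegral_map' hsq.aemeasurable (by fun_prop),
    ← lintegral_const_mul' _ _ ENNReal.ofReal_ne_top]
  refine lintegral_congr fun ω ↦ ?_
  rw [mul_pow, ← ENNReal.coe_pow, NNReal.sq_sqrt]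
  rfl

/-- The tangent to `1/x` at `c` lies below the curve: `2/c - x/c² ≤ 1/x` with `x = d²`. Since `t >
0`, the truncated subtraction is a genuine one and `d = ∞` is excluded. -/
lemma sqrt_mul_le_one_of_le {t c : ℝ} (ht : 0 < t) (hc : 0 < c) {d : ℝ≥0∞}
    (h : ENNReal.ofReal t ≤ ENNReal.ofReal (2 / c) - d ^ 2 / ENNReal.ofReal (c ^ 2)) :
    (NNReal.sqrt t.toNNReal : ℝ≥0∞) * d ≤ 1 := by
  have hc2 : ENNReal.ofReal (c ^ 2) ≠ 0 := by simp; positivity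
  induction d with
  | top =>
    rw [ENNReal.top_pow two_ne_zero, ENNReal.top_div_of_ne_top ENNReal.ofReal_ne_top] at h
    simp at h
    linarith
  | coe d =>
    have h1 : (d : ℝ≥0∞) ^ 2 / ENNReal.ofReal (c ^ 2) = ENNReal.ofReal (d ^ 2 / c ^ 2) := by
      rw [ENNReal.ofReal_div_of_pos (by positivity), ENNReal.ofReal_pow NNReal.zero_le_coe,
        ENNReal.ofReal_coe_nnreal]
    rw [h1, ← ENNReal.ofReal_sub _ (by positivity), ENNReal.ofReal_le_ofReal_iff'] at h
    have h2 : t ≤ 2 / c - d ^ 2 / c ^ 2 := h.resolve_right ht.not_ge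
    have h3 : t * (d : ℝ) ^ 2 ≤ 1 := by
      have h4 := mul_le_mul_of_nonneg_right h2 (sq_nonneg (d : ℝ))
      have h5 : (2 / c - (d : ℝ) ^ 2 / c ^ 2) * d ^ 2 = 1 - (1 - d ^ 2 / c) ^ 2 := by
        field_simp
        ring
      nlinarith [sq_nonneg (1 - (d : ℝ) ^ 2 / c)]
    have h6 : t.toNNReal.sqrt * d ≤ 1 := by
      rw [← pow_le_one_iff_of_nonneg zero_le two_ne_zero, mul_pow, NNReal.sq_sqrt,
        ← NNReal.coe_le_coe]
      push_cast
      rwa [Real.coe_toNNReal _ ht.le]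
    exact_mod_cast h6

lemma IsBrownianMotion.lower_bound [IsProbabilityMeasure P] (hW : IsBrownianMotion W P)
    (hn : 1 ≤ n) :
    ENNReal.ofReal (1 / (4 * Real.log 2) * (1 / (n : ℝ))) ≤
      ∫⁻ ω, inverseDiameterTime W 1 ω ∂P := by
  set c : ℝ := 4 * n * Real.log 2 with hc
  have hn' : (0 : ℝ) < n := by exact_mod_cast hn
  have hc0 : 0 < c := by have := Real.log_pos one_lt_two; positivity
  have m1 := hW.aemeasurable_hullDiameter 1
  let V (ω : Ω) : ℝ≥0∞ :=
    ENNReal.ofReal (2 / c) - hullDiameter (fun s ↦ W s ω) 1 ^ 2 / ENNReal.ofReal (c ^ 2)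
  have mV : AEMeasurable V P := by fun_prop
  -- Jensen through the tangent line: `2/c - E[D_1²]/c² ≥ 1/c`, because `E[D_1²] ≤ c`.
  have hV : ENNReal.ofReal (1 / c) ≤ ∫⁻ ω, V ω ∂P := by
    refine le_trans ?_ (lintegral_sub_le' _ _ ?_)
    · rw [lintegral_const, measure_univ, mul_one]
      simp_rw [div_eq_mul_inv (_ ^ 2)]
      rw [lintegral_mul_const'' _ (by fun_prop)]
      grw [hW.lintegral_sq_hullDiameter_le]
      rw [← hc, ← ENNReal.ofReal_inv_of_pos (by positivity), ← ENNReal.ofReal_mul hc0.le,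
        ← ENNReal.ofReal_sub _ (by positivity)]
      apply ENNReal.ofReal_le_ofReal
      apply le_of_eq
      field_simp
      ring
    · fun_prop
  calc _ = ENNReal.ofReal (1 / c) := by
        congr 1
        rw [hc]
        field_simp
    _ ≤ ∫⁻ ω, V ω ∂P := hV
    _ = ∫⁻ t in Set.Ioi (0 : ℝ), P {ω | ENNReal.ofReal t ≤ V ω} :=
        lintegral_eq_lintegral_meas_ofReal_le mV
    _ ≤ ∫⁻ t in Set.Ioi (0 : ℝ), P {ω | ENNReal.ofReal t ≤ inverseDiameterTime W 1 ω} := by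
        refine setLIntegral_mono' measurableSet_Ioi fun t ht ↦ ?_
        have ht0 : 0 < t := ht
        have hs := hW.map_hullDiameter t.toNNReal (Real.toNNReal_pos.2 ht0).ne'
        have mt := hW.aemeasurable_hullDiameter t.toNNReal
        calc _ ≤ P ((fun ω ↦ (NNReal.sqrt t.toNNReal : ℝ≥0∞) * hullDiameter (fun s ↦ W s ω) 1) ⁻¹'
              Set.Iic 1) := measure_mono fun ω hω ↦ sqrt_mul_le_one_of_le ht0 hc0 hω
          _ = P ((fun ω ↦ hullDiameter (fun s ↦ W s ω) t.toNNReal) ⁻¹' Set.Iic 1) := by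
              rw [← Measure.map_apply_of_aemeasurable (by fun_prop) measurableSet_Iic, ← hs,
                Measure.map_apply_of_aemeasurable mt measurableSet_Iic]
          _ ≤ _ := measure_mono fun ω hω ↦ le_inverseProcess (hullDiameter_mono _) hω
    _ = _ := (lintegral_eq_lintegral_meas_ofReal_le (hW.aemeasurable_inverseDiameterTime 1)).symm

end LowerBound

/-! ### Independence of increments and the exit from the unit ball. -/

section ExitTime

variable {Ω : Type*} [MeasurableSpace Ω] {P : Measure Ω} {n : ℕ}
  {W : ℝ≥0 → Ω → EuclideanSpace ℝ (Fin n)}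

lemma IsBrownianMotion.aemeasurable (hW : IsBrownianMotion W P) (t : ℝ≥0) :
    AEMeasurable (W t) P := by
  have : AEMeasurable (fun ω j ↦ W t ω j) P :=
    aemeasurable_pi_lambda _ fun j ↦ (hW.coord j).aemeasurable t
  exact (WithLp.measurable_toLp 2 (Fin n → ℝ)).comp_aemeasurable this

/-- The coordinates of a Brownian motion form a joint Gaussian process. -/
lemma IsBrownianMotion.isGaussianProcess (hW : IsBrownianMotion W P) :
    IsGaussianProcess (fun (p : Fin n × ℝ≥0) ω ↦ W p.2 ω p.1) P where
  hasGaussianLaw I := by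
    classical
    let J : Finset ℝ≥0 := I.image Prod.snd
    have i1 : iIndepFun (fun (j : Fin n) ω (t : J) ↦ W t ω j) P :=
      hW.indep.comp (fun _ x (t : J) ↦ x t)
        fun j ↦ measurable_pi_lambda _ fun t ↦ measurable_pi_apply _
    have h1 := i1.hasGaussianLaw fun j ↦
      (IsPreBrownianReal.isGaussianProcess (hW.coord j).toIsPreBrownianReal).hasGaussianLaw J
    let L : (Fin n → J → ℝ) →L[ℝ] I → ℝ :=
      { toFun x p := x p.1.1 ⟨p.1.2, Finset.mem_image_of_mem _ p.2⟩
        map_add' x y := by ext; simp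
        map_smul' c x := by ext; simp }
    exact h1.map L

/-- Each coordinate increment is independent of the past of the whole motion. -/
lemma IsBrownianMotion.indepFun_increment [IsProbabilityMeasure P] (hW : IsBrownianMotion W P)
    (s u : ℝ≥0) (j : Fin n) :
    IndepFun (fun ω ↦ W (s + u) ω j - W s ω j)
      (fun ω (p : Fin n × Set.Iic s) ↦ W p.2 ω p.1) P := by
  have hmL (i : Fin n) (t : ℝ≥0) : MemLp (fun ω ↦ W t ω i) 2 P :=
    ((IsPreBrownianReal.isGaussianProcess
      (hW.coord i).toIsPreBrownianReal).hasGaussianLaw_eval t).memLp_two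
  -- For jointly Gaussian families independence follows from zero covariance; the increment is
  -- viewed as a family over `Unit`.
  have main : IndepFun (fun ω (_ : Unit) ↦ W (s + u) ω j - W s ω j)
      (fun ω (p : Fin n × Set.Iic s) ↦ W p.2 ω p.1) P := by
    apply IsGaussianProcess.indepFun_of_covariance_eq_zero
      (X := fun (_ : Unit) ω ↦ W (s + u) ω j - W s ω j)
      (Y := fun (p : Fin n × Set.Iic s) ω ↦ W p.2 ω p.1)
    · apply hW.isGaussianProcess.of_isGaussianProcess
      classical
      rintro (_ | ⟨i, t⟩)
      · exact ⟨{(j, s), (j, s + u)},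
          { toFun x := x ⟨(j, s + u), by simp⟩ - x ⟨(j, s), by simp⟩
            map_add' x y := by simp; abel
            map_smul' c x := by simp; ring }, by simp⟩
      · exact ⟨{(i, t.1)},
          { toFun x := x ⟨(i, t.1), by simp⟩
            map_add' x y := by simp
            map_smul' c x := by simp }, by simp⟩
    · exact fun _ ↦ ((hmL j (s + u)).sub (hmL j s)).aemeasurable
    · exact fun p ↦ (hmL _ _).aemeasurable
    · rintro _ ⟨i, t, ht : t ≤ s⟩
      rw [covariance_fun_sub_left (hmL _ _) (hmL _ _) (hmL _ _)]
      by_cases hij : j = i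
      · subst hij
        rw [(hW.coord j).covariance_fun_eval, (hW.coord j).covariance_fun_eval,
          min_eq_right ht, min_eq_right (ht.trans le_self_add), sub_self]
      · have hind (r : ℝ≥0) : IndepFun (fun ω ↦ W r ω j) (fun ω ↦ W t ω i) P :=
          (hW.indep.indepFun hij).comp (φ := fun x : ℝ≥0 → ℝ ↦ x r)
            (ψ := fun x : ℝ≥0 → ℝ ↦ x t) (measurable_pi_apply (X := fun _ ↦ ℝ) r)
            (measurable_pi_apply (X := fun _ ↦ ℝ) t)
        rw [(hind _).covariance_eq_zero (hmL _ _) (hmL _ _),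
          (hind _).covariance_eq_zero (hmL _ _) (hmL _ _), sub_self]
  exact main.comp (φ := fun x : Unit → ℝ ↦ x ())
    (measurable_pi_apply (X := fun _ ↦ ℝ) ()) measurable_id

lemma IsBrownianMotion.indepFun_grid [IsProbabilityMeasure P] (hW : IsBrownianMotion W P)
    (h : ℝ≥0) (k : ℕ) (j : Fin n) :
    IndepFun (fun ω ↦ W ((k + 1 : ℕ) * h) ω j - W (k * h) ω j)
      (fun ω (i : ℕ) ↦ W ((min i k : ℕ) * h) ω) P := by
  have hle (i : ℕ) : ((min i k : ℕ) : ℝ≥0) * h ∈ Set.Iic (k * h) := by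
    simp only [Set.mem_Iic]; gcongr; exact min_le_right _ _
  have m2 : Measurable fun (x : Fin n × Set.Iic ((k : ℝ≥0) * h) → ℝ) (i : ℕ) ↦
      (WithLp.toLp 2 fun j ↦ x (j, ⟨_, hle i⟩) : EuclideanSpace ℝ (Fin n)) := by
    fun_prop
  have := (hW.indepFun_increment (k * h) h j).comp measurable_id m2
  convert this using 1
  · funext ω
    simp [add_mul]
  · rfl

open Classical in
/-- Indicator that a sequence stays in the closed unit ball up to time `k`. -/
noncomputable def stays (k : ℕ) (x : ℕ → EuclideanSpace ℝ (Fin n)) : ℝ :=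
  if ∀ i ≤ k, ‖x i‖ ≤ 1 then 1 else 0

lemma stays_comp_min (k : ℕ) (x : ℕ → EuclideanSpace ℝ (Fin n)) :
    stays k (fun i ↦ x (min i k)) = stays k x := by
  have : (∀ i ≤ k, ‖x (min i k)‖ ≤ 1) ↔ ∀ i ≤ k, ‖x i‖ ≤ 1 :=
    forall₂_congr fun i hi ↦ by rw [min_eq_left hi]
  simp only [stays, this]

lemma measurableSet_stays (k : ℕ) :
    MeasurableSet {x : ℕ → EuclideanSpace ℝ (Fin n) | ∀ i ≤ k, ‖x i‖ ≤ 1} := by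
  have : {x : ℕ → EuclideanSpace ℝ (Fin n) | ∀ i ≤ k, ‖x i‖ ≤ 1} =
      ⋂ i, ⋂ (_ : i ≤ k), {x | ‖x i‖ ≤ 1} := by ext; simp
  rw [this]
  refine MeasurableSet.iInter fun i ↦ MeasurableSet.iInter fun _ ↦ ?_
  exact measurableSet_le (measurable_pi_apply i).norm measurable_const

@[fun_prop]
lemma measurable_stays (k : ℕ) :
    Measurable (stays k : (ℕ → EuclideanSpace ℝ (Fin n)) → ℝ) :=
  Measurable.ite (measurableSet_stays k) measurable_const measurable_const

/-- Here `x` is the size of the exit step. A step below `δ` costs at most `(1 + δ)²`; for a larger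
one, `1 ≤ x/δ` twice gives `1 + x ≤ (1 + 1/δ) x² / δ`. -/
lemma one_add_sq_le {δ x : ℝ} (hδ : 0 < δ) (hx : 0 ≤ x) :
    (1 + x) ^ 2 ≤ (1 + δ) ^ 2 + ((1 + 1 / δ) / δ) ^ 2 * x ^ 4 := by
  rcases le_total x δ with h | h
  · have : (1 + x) ^ 2 ≤ (1 + δ) ^ 2 := by gcongr
    have h2 : 0 ≤ ((1 + 1 / δ) / δ) ^ 2 * x ^ 4 := by positivity
    linarith
  · have h1 : 1 ≤ x / δ := (one_le_div hδ).2 h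
    have h2 : 1 + x ≤ (1 + 1 / δ) / δ * x ^ 2 := by
      calc 1 + x ≤ x / δ + x := by gcongr
        _ = (1 + 1 / δ) * x * 1 := by ring
        _ ≤ (1 + 1 / δ) * x * (x / δ) := by gcongr
        _ = _ := by ring
    have h3 : (1 + x) ^ 2 ≤ ((1 + 1 / δ) / δ * x ^ 2) ^ 2 := by gcongr
    have h4 : ((1 + 1 / δ) / δ * x ^ 2) ^ 2 = ((1 + 1 / δ) / δ) ^ 2 * x ^ 4 := by ring
    have h5 : 0 ≤ (1 + δ) ^ 2 := by positivity
    linarith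

/-- The squared norm at the exit from the unit ball, as a telescoping sum. -/
lemma sum_stays_mul_le {δ : ℝ} (hδ : 0 < δ) (x : ℕ → EuclideanSpace ℝ (Fin n)) (N : ℕ) :
    ∑ k ∈ Finset.range N, stays k x * (‖x (k + 1)‖ ^ 2 - ‖x k‖ ^ 2) ≤
      (1 + δ) ^ 2 +
        ((1 + 1 / δ) / δ) ^ 2 * ∑ k ∈ Finset.range N, ‖x (k + 1) - x k‖ ^ 4 := by
  set C := ((1 + 1 / δ) / δ) ^ 2
  have hC : 0 ≤ C := by positivity
  -- Once the sequence has left the ball, its squared norm at the exit is replaced by `(1 + δ)²`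
  -- plus the fourth-power term of the exit step; later summands vanish.
  have main : ∀ N, ∑ k ∈ Finset.range N, stays k x * (‖x (k + 1)‖ ^ 2 - ‖x k‖ ^ 2) ≤
      stays N x * ‖x N‖ ^ 2 + (1 - stays N x) * (1 + δ) ^ 2 +
        C * ∑ k ∈ Finset.range N, ‖x (k + 1) - x k‖ ^ 4 := by
    intro N
    induction N with
    | zero =>
      unfold stays
      split_ifs <;> simp
      positivity
    | succ N ih =>
      rw [Finset.sum_range_succ, Finset.sum_range_succ, mul_add]
      have h4 : 0 ≤ C * ‖x (N + 1) - x N‖ ^ 4 := by positivity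
      by_cases h1 : ∀ i ≤ N, ‖x i‖ ≤ 1
      · have e1 : stays N x = 1 := if_pos h1
        rw [e1] at ih ⊢
        by_cases h2 : ‖x (N + 1)‖ ≤ 1
        · have e2 : stays (N + 1) x = 1 := if_pos fun i hi ↦ by
            rcases Nat.le_succ_iff.1 hi with h | rfl
            exacts [h1 i h, h2]
          rw [e2]
          linarith
        · have e2 : stays (N + 1) x = 0 := if_neg fun h ↦ h2 (h _ le_rfl)
          rw [e2]
          have h5 : ‖x (N + 1)‖ ≤ 1 + ‖x (N + 1) - x N‖ := by
            have := norm_le_norm_add_norm_sub (x N) (x (N + 1))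
            have := h1 N le_rfl
            rw [norm_sub_rev]
            linarith
          have h6 : ‖x (N + 1)‖ ^ 2 ≤ (1 + ‖x (N + 1) - x N‖) ^ 2 := by gcongr
          have h7 := one_add_sq_le hδ (norm_nonneg (x (N + 1) - x N))
          linarith
      · have e1 : stays N x = 0 := if_neg h1
        have e2 : stays (N + 1) x = 0 := if_neg fun h ↦ h1 fun i hi ↦ h i (hi.trans N.le_succ)
        rw [e1] at ih ⊢
        rw [e2]
        linarith
  refine (main N).trans ?_
  gcongr
  unfold stays
  split_ifs with h
  · have h1 : ‖x N‖ ^ 2 ≤ 1 := pow_le_one₀ (norm_nonneg _) (h N le_rfl)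
    nlinarith
  · simp

end ExitTime

/-! ### Moments of the increments, optional stopping and the upper bound. -/

section UpperBound

variable {Ω : Type*} [MeasurableSpace Ω] {P : Measure Ω} {n : ℕ}
  {W : ℝ≥0 → Ω → EuclideanSpace ℝ (Fin n)}

/-- The fourth moment of the standard Gaussian. -/
noncomputable def gaussianFourthMoment : ℝ := ∫ x, x ^ 4 ∂gaussianReal 0 1

lemma integrable_pow_gaussianReal (v : ℝ≥0) (p : ℕ) :
    Integrable (fun x : ℝ ↦ x ^ p) (gaussianReal 0 v) := by
  have := (memLp_id_gaussianReal (μ := 0) (v := v) p).integrable_norm_pow'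
  refine (integrable_norm_iff (by fun_prop)).1 ?_
  simpa using this

/-- By scaling. Only the order `v²` matters, so the moment of the standard Gaussian is never
evaluated. -/
lemma integral_pow_four_gaussianReal (v : ℝ≥0) :
    ∫ x, x ^ 4 ∂gaussianReal 0 v = v ^ 2 * gaussianFourthMoment := by
  have h1 : gaussianReal 0 v = (gaussianReal 0 1).map (√v * ·) := by
    rw [gaussianReal_map_const_mul]
    congr 1
    · simp
    · ext; simp
  rw [h1, integral_map (by fun_prop) (by fun_prop), gaussianFourthMoment, ← integral_const_mul]
  congr with x
  have : (√(v : ℝ)) ^ 4 = v ^ 2 := by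
    rw [show 4 = 2 * 2 from rfl, pow_mul, Real.sq_sqrt NNReal.zero_le_coe]
  rw [mul_pow, this]

lemma IsBrownianMotion.hasLaw_increment (hW : IsBrownianMotion W P) (h : ℝ≥0) (k : ℕ)
    (j : Fin n) :
    HasLaw (fun ω ↦ W ((k + 1 : ℕ) * h) ω j - W (k * h) ω j) (gaussianReal 0 h) P :=
  (isGaussianWalk_of_isPreBrownianReal (hW.coord j).toIsPreBrownianReal h).law k

lemma IsBrownianMotion.integrable_increment_pow (hW : IsBrownianMotion W P) (h : ℝ≥0) (k : ℕ)
    (j : Fin n) (p : ℕ) :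
    Integrable (fun ω ↦ (W ((k + 1 : ℕ) * h) ω j - W (k * h) ω j) ^ p) P := by
  have hl := hW.hasLaw_increment h k j
  have := integrable_pow_gaussianReal h p
  rw [← hl.map_eq] at this
  exact this.comp_aemeasurable hl.aemeasurable

lemma IsBrownianMotion.integral_increment_pow (hW : IsBrownianMotion W P) (h : ℝ≥0) (k : ℕ)
    (j : Fin n) (p : ℕ) :
    ∫ ω, (W ((k + 1 : ℕ) * h) ω j - W (k * h) ω j) ^ p ∂P = ∫ x, x ^ p ∂gaussianReal 0 h := by
  have hl := hW.hasLaw_increment h k j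
  rw [← hl.map_eq, integral_map hl.aemeasurable (by fun_prop)]

lemma stays_nonneg (k : ℕ) (x : ℕ → EuclideanSpace ℝ (Fin n)) : 0 ≤ stays k x := by
  unfold stays; split_ifs <;> simp

lemma stays_le_one (k : ℕ) (x : ℕ → EuclideanSpace ℝ (Fin n)) : stays k x ≤ 1 := by
  unfold stays; split_ifs <;> simp

lemma abs_stays_mul_apply_le (k : ℕ) (x : ℕ → EuclideanSpace ℝ (Fin n)) (j : Fin n) :
    |stays k x * x k j| ≤ 1 := by
  unfold stays
  split_ifs with h
  · rw [one_mul]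
    exact (PiLp.norm_apply_le (x k) j).trans (h k le_rfl)
  · simp

variable [IsProbabilityMeasure P]

lemma IsBrownianMotion.integrable_stays (hW : IsBrownianMotion W P) (h : ℝ≥0) (k : ℕ) :
    Integrable (fun ω ↦ stays k fun i : ℕ ↦ W (i * h) ω) P := by
  have hm : AEMeasurable (fun ω (i : ℕ) ↦ W (i * h) ω) P :=
    aemeasurable_pi_lambda _ fun i ↦ hW.aemeasurable _
  refine Integrable.of_bound ((measurable_stays k).comp_aemeasurable hm).aestronglyMeasurable 1
    (ae_of_all _ fun ω ↦ ?_)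
  rw [Real.norm_eq_abs, abs_of_nonneg (stays_nonneg _ _)]
  exact stays_le_one _ _

lemma IsBrownianMotion.integral_stays_mul_coord (hW : IsBrownianMotion W P) (h : ℝ≥0) (k : ℕ)
    (j : Fin n) :
    Integrable (fun ω ↦ (stays k fun i : ℕ ↦ W (i * h) ω) *
      (W ((k + 1 : ℕ) * h) ω j ^ 2 - W (k * h) ω j ^ 2)) P ∧
    ∫ ω, (stays k fun i : ℕ ↦ W (i * h) ω) *
      (W ((k + 1 : ℕ) * h) ω j ^ 2 - W (k * h) ω j ^ 2) ∂P =
      h * ∫ ω, (stays k fun i : ℕ ↦ W (i * h) ω) ∂P := by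
  have hm : AEMeasurable (fun ω (i : ℕ) ↦ W (i * h) ω) P :=
    aemeasurable_pi_lambda _ fun i ↦ hW.aemeasurable _
  set D : Ω → ℝ := fun ω ↦ W ((k + 1 : ℕ) * h) ω j - W (k * h) ω j with hD
  set G : Ω → ℝ := fun ω ↦ stays k fun i : ℕ ↦ W (i * h) ω with hG
  let H : Ω → ℝ := fun ω ↦ G ω * W (k * h) ω j
  have mG : AEMeasurable G P := (measurable_stays k).comp_aemeasurable hm
  have mcoord : Measurable fun x : ℕ → EuclideanSpace ℝ (Fin n) ↦ x k j := by fun_prop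
  have mH : AEMeasurable H P := mG.mul (mcoord.comp_aemeasurable hm)
  have mD : AEMeasurable D P := (hW.hasLaw_increment h k j).aemeasurable
  have hind := hW.indepFun_grid h k j
  have i1 : IndepFun G (fun ω ↦ D ω ^ 2) P := by
    have := (hind.comp (measurable_id.pow_const 2) (measurable_stays k)).symm
    convert this using 1
    swap; · rfl
    funext ω
    exact (stays_comp_min k fun i : ℕ ↦ W (i * h) ω).symm
  have i2 : IndepFun H D P := by
    have := (hind.comp measurable_id ((measurable_stays k).mul mcoord)).symm
    convert this using 1
    swap; · rfl
    funext ω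
    simp only [Function.comp_apply, Pi.mul_apply, min_self]
    exact congrArg (· * _) (stays_comp_min k fun i : ℕ ↦ W (i * h) ω).symm
  have iG : Integrable G P := hW.integrable_stays h k
  have iH : Integrable H P := Integrable.of_bound mH.aestronglyMeasurable 1
    (ae_of_all _ fun ω ↦ abs_stays_mul_apply_le k (fun i : ℕ ↦ W (i * h) ω) j)
  have iD : Integrable D P := by simpa [D] using hW.integrable_increment_pow h k j 1
  have iD2 : Integrable (fun ω ↦ D ω ^ 2) P := hW.integrable_increment_pow h k j 2
  have eD : ∫ ω, D ω ∂P = 0 := by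
    have := hW.integral_increment_pow h k j 1
    simpa [D] using this
  have eD2 : ∫ ω, D ω ^ 2 ∂P = h := by
    rw [hD, hW.integral_increment_pow h k j 2]
    have := variance_fun_id_gaussianReal (μ := 0) (v := h)
    rw [variance_of_integral_eq_zero (by fun_prop) (by simp)] at this
    exact this
  -- `b² - a² = 2a(b - a) + (b - a)²`: the cross term has mean zero by independence from the past,
  -- and the square contributes `h`.
  have e : (fun ω ↦ G ω * (W ((k + 1 : ℕ) * h) ω j ^ 2 - W (k * h) ω j ^ 2)) =
      fun ω ↦ 2 * (H ω * D ω) + G ω * D ω ^ 2 := by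
    funext ω
    simp only [H, D]
    ring
  have j1 : Integrable (fun ω ↦ H ω * D ω) P := i2.integrable_mul iH iD
  have j2 : Integrable (fun ω ↦ G ω * D ω ^ 2) P := i1.integrable_mul iG iD2
  rw [e]
  refine ⟨(j1.const_mul 2).add j2, ?_⟩
  rw [integral_add (j1.const_mul 2) j2, integral_const_mul,
    i2.integral_fun_mul_eq_mul_integral mH.aestronglyMeasurable mD.aestronglyMeasurable,
    i1.integral_fun_mul_eq_mul_integral mG.aestronglyMeasurable iD2.aestronglyMeasurable, eD, eD2]
  ring

/-- Discrete optional stopping: the expected number of steps in the unit ball. -/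
lemma IsBrownianMotion.sum_integral_stays_le (hW : IsBrownianMotion W P) (h : ℝ≥0) {δ : ℝ}
    (hδ : 0 < δ) (N : ℕ) :
    n * h * ∑ k ∈ Finset.range N, ∫ ω, (stays k fun i : ℕ ↦ W (i * h) ω) ∂P ≤
      (1 + δ) ^ 2 +
        ((1 + 1 / δ) / δ) ^ 2 * (N * (n * (n * (h ^ 2 * gaussianFourthMoment)))) := by
  have hstep (k : ℕ) : Integrable (fun ω ↦ (stays k fun i : ℕ ↦ W (i * h) ω) *
        (‖W ((k + 1 : ℕ) * h) ω‖ ^ 2 - ‖W (k * h) ω‖ ^ 2)) P ∧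
      ∫ ω, (stays k fun i : ℕ ↦ W (i * h) ω) *
        (‖W ((k + 1 : ℕ) * h) ω‖ ^ 2 - ‖W (k * h) ω‖ ^ 2) ∂P =
      n * h * ∫ ω, (stays k fun i : ℕ ↦ W (i * h) ω) ∂P := by
    simp_rw [EuclideanSpace.real_norm_sq_eq, ← Finset.sum_sub_distrib, Finset.mul_sum]
    refine ⟨integrable_finsetSum _ fun j _ ↦ (hW.integral_stays_mul_coord h k j).1, ?_⟩
    rw [integral_finsetSum _ fun j _ ↦ (hW.integral_stays_mul_coord h k j).1,
      Finset.sum_congr rfl fun j _ ↦ (hW.integral_stays_mul_coord h k j).2]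
    simp [mul_assoc]
  have hfour (k : ℕ) : Integrable (fun ω ↦ ‖W ((k + 1 : ℕ) * h) ω - W (k * h) ω‖ ^ 4) P ∧
      ∫ ω, ‖W ((k + 1 : ℕ) * h) ω - W (k * h) ω‖ ^ 4 ∂P ≤
        n * (n * (h ^ 2 * gaussianFourthMoment)) := by
    have hb ω : ‖W ((k + 1 : ℕ) * h) ω - W (k * h) ω‖ ^ 4 ≤
        n * ∑ j, (W ((k + 1 : ℕ) * h) ω j - W (k * h) ω j) ^ 4 := by
      have := sq_sum_le_card_mul_sum_sq (s := Finset.univ)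
        (f := fun j : Fin n ↦ (W ((k + 1 : ℕ) * h) ω j - W (k * h) ω j) ^ 2)
      simp only [← pow_mul, Finset.card_univ, Fintype.card_fin] at this
      rw [show 4 = 2 * 2 from rfl, pow_mul, EuclideanSpace.real_norm_sq_eq]
      exact this
    have hi : Integrable (fun ω ↦ n * ∑ j, (W ((k + 1 : ℕ) * h) ω j - W (k * h) ω j) ^ 4) P :=
      (integrable_finsetSum _ fun j _ ↦ hW.integrable_increment_pow h k j 4).const_mul _
    have mw := hW.aemeasurable
    have hi' : Integrable (fun ω ↦ ‖W ((k + 1 : ℕ) * h) ω - W (k * h) ω‖ ^ 4) P := by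
      refine hi.mono' ((((mw _).sub (mw _)).norm.pow_const 4).aestronglyMeasurable)
        (ae_of_all _ fun ω ↦ ?_)
      rw [Real.norm_eq_abs, abs_of_nonneg (by positivity)]
      exact hb ω
    refine ⟨hi', (integral_mono hi' hi hb).trans_eq ?_⟩
    rw [integral_const_mul, integral_finsetSum _ fun j _ ↦ hW.integrable_increment_pow h k j 4,
      Finset.sum_congr rfl fun j _ ↦ (hW.integral_increment_pow h k j 4).trans
        (integral_pow_four_gaussianReal h)]
    simp
  have hint := integral_mono
    (integrable_finsetSum (Finset.range N) fun k _ ↦ (hstep k).1)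
    ((integrable_const ((1 + δ) ^ 2)).add
      ((integrable_finsetSum (Finset.range N) fun k _ ↦ (hfour k).1).const_mul
        (((1 + 1 / δ) / δ) ^ 2)))
    (fun ω ↦ sum_stays_mul_le hδ (fun i : ℕ ↦ W (i * h) ω) N)
  simp only [Pi.add_apply] at hint
  rw [integral_finsetSum _ fun k _ ↦ (hstep k).1, integral_add (integrable_const _)
    ((integrable_finsetSum (Finset.range N) fun k _ ↦ (hfour k).1).const_mul _),
    integral_const_mul, integral_finsetSum _ fun k _ ↦ (hfour k).1,
    Finset.sum_congr rfl fun k _ ↦ (hstep k).2, ← Finset.mul_sum] at hint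
  refine hint.trans ?_
  simp only [integral_const, probReal_univ, one_smul]
  gcongr
  refine (Finset.sum_le_sum fun k _ ↦ (hfour k).2).trans_eq ?_
  simp

/-- If `Θ ≥ t > kh`, the diameter at time `kh` is at most `1`, and the distance to the starting
point `0` is one of the distances it bounds. Strictness of `kh < t` is needed because `D` may exceed
`1` right after `Θ`. -/
lemma IsBrownianMotion.measure_le_integral_stays (hW : IsBrownianMotion W P) (h : ℝ≥0) (k : ℕ)
    {t : ℝ} (ht : k * h < t) :
    P {ω | ENNReal.ofReal t ≤ inverseDiameterTime W 1 ω} ≤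
      ENNReal.ofReal (∫ ω, (stays k fun i : ℕ ↦ W (i * h) ω) ∂P) := by
  rw [ofReal_integral_eq_lintegral_ofReal (hW.integrable_stays h k)
    (ae_of_all _ fun ω ↦ stays_nonneg _ _)]
  have hs : NullMeasurableSet {ω | ENNReal.ofReal t ≤ inverseDiameterTime W 1 ω} P :=
    nullMeasurableSet_le aemeasurable_const (hW.aemeasurable_inverseDiameterTime 1)
  rw [← lintegral_indicator_one₀ hs]
  refine lintegral_mono_ae ?_
  filter_upwards [ae_all_iff.2 fun j ↦ (hW.coord j).eval_zero_ae_eq_zero] with ω hω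
  rw [Set.indicator_apply]
  split_ifs with hω'
  swap; · exact zero_le
  have hD : hullDiameter (fun s ↦ W s ω) (k * h) ≤ 1 := by
    refine le_of_lt_inverseProcess (lt_of_lt_of_le ?_ hω')
    rw [← ENNReal.ofReal_coe_nnreal, ENNReal.ofReal_lt_ofReal_iff_of_nonneg NNReal.zero_le_coe]
    exact_mod_cast ht
  have h0 : W 0 ω = 0 := by
    ext j
    exact hω j
  have hst : (stays k fun i : ℕ ↦ W (i * h) ω) = 1 := by
    refine if_pos fun i hi ↦ ?_
    have := (edist_le_hullDiameter (fun s ↦ W s ω) (s := i * h) (s' := 0) (t := k * h)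
      (by gcongr) zero_le).trans hD
    rw [h0, edist_zero_right, ← ofReal_norm, ENNReal.ofReal_le_one] at this
    exact this
  rw [hst]
  simp

lemma IsBrownianMotion.upper_bound (hW : IsBrownianMotion W P) (hn : 1 ≤ n) :
    ∫⁻ ω, inverseDiameterTime W 1 ω ∂P ≤ ENNReal.ofReal (1 / (n : ℝ)) := by
  have hn' : (0 : ℝ) < n := by exact_mod_cast hn
  rw [lintegral_eq_lintegral_meas_ofReal_le (hW.aemeasurable_inverseDiameterTime 1)]
  refine setLIntegral_Ioi_le_of_forall_Ioc fun T ↦ ?_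
  -- The error term is `O(1/N)` for fixed `δ` and `T`, so `N → ∞` must precede `δ → 0`.
  have key (δ : ℝ) (hδ : 0 < δ) (N : ℕ) (hN : 0 < N) :
      ∫⁻ t in Set.Ioc 0 (T : ℝ), P {ω | ENNReal.ofReal t ≤ inverseDiameterTime W 1 ω} ≤
        ENNReal.ofReal (((1 + δ) ^ 2 + ((1 + 1 / δ) / δ) ^ 2 *
          (n * (n * ((T : ℝ) ^ 2 * gaussianFourthMoment))) / N) / n) := by
    have hN' : (0 : ℝ) < N := by exact_mod_cast hN
    set h : ℝ≥0 := T / N with hh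
    have hh' : (h : ℝ) = T / N := by simp [hh]
    have hT : (T : ℝ) = N * h := by rw [hh']; field_simp
    have h1 := hW.sum_integral_stays_le h hδ N
    rw [← restrict_Ico_eq_restrict_Ioc, hT, setLIntegral_Ico_eq_sum _ NNReal.zero_le_coe]
    calc _ ≤ ∑ k ∈ Finset.range N,
          ENNReal.ofReal (∫ ω, (stays k fun i : ℕ ↦ W (i * h) ω) ∂P) * ENNReal.ofReal h := by
          refine Finset.sum_le_sum fun k _ ↦ ?_
          -- Half-open on the left, to have `k * h < t` strictly.
          rw [restrict_Ico_eq_restrict_Ioc]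
          refine (setLIntegral_mono' measurableSet_Ioc fun t ht ↦
            hW.measure_le_integral_stays h k ht.1).trans_eq ?_
          rw [setLIntegral_const, Real.volume_Ioc]
          congr 2
          ring
      _ = ENNReal.ofReal
          ((∑ k ∈ Finset.range N, ∫ ω, (stays k fun i : ℕ ↦ W (i * h) ω) ∂P) * h) := by
          rw [← Finset.sum_mul, ← ENNReal.ofReal_sum_of_nonneg, ENNReal.ofReal_mul]
          · exact Finset.sum_nonneg fun k _ ↦ integral_nonneg fun ω ↦ stays_nonneg _ _
          · exact fun k _ ↦ integral_nonneg fun ω ↦ stays_nonneg _ _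
      _ ≤ _ := by
          apply ENNReal.ofReal_le_ofReal
          rw [le_div_iff₀ hn']
          refine le_trans (le_of_eq ?_) (h1.trans_eq ?_)
          · ring
          · field_simp
  have lim1 (δ : ℝ) (hδ : 0 < δ) :
      ∫⁻ t in Set.Ioc 0 (T : ℝ), P {ω | ENNReal.ofReal t ≤ inverseDiameterTime W 1 ω} ≤
        ENNReal.ofReal (((1 + δ) ^ 2 + 0) / n) := by
    refine ge_of_tendsto (ENNReal.tendsto_ofReal
      ((tendsto_const_nhds.add (tendsto_const_div_atTop_nhds_zero_nat
        (((1 + 1 / δ) / δ) ^ 2 * (n * (n * ((T : ℝ) ^ 2 * gaussianFourthMoment)))))).div_const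
        (n : ℝ))) ?_
    filter_upwards [Filter.eventually_gt_atTop 0] with N hN
    exact key δ hδ N hN
  have hc : Filter.Tendsto (fun δ : ℝ ↦ ENNReal.ofReal (((1 + δ) ^ 2 + 0) / n))
      (nhdsWithin 0 (Set.Ioi 0)) (nhds (ENNReal.ofReal (((1 + 0) ^ 2 + 0) / n))) := by
    refine ENNReal.tendsto_ofReal (Filter.Tendsto.mono_left ?_ nhdsWithin_le_nhds)
    exact Continuous.tendsto (by fun_prop) 0
  have := ge_of_tendsto hc (Filter.eventually_of_mem self_mem_nhdsWithin lim1)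
  simpa using this

end UpperBound

end BrownianHull

theorem theorem4 {Ω : Type*} [MeasurableSpace Ω] (P : Measure Ω) [IsProbabilityMeasure P]
    (n : ℕ) (hn : 1 ≤ n) (W : ℝ≥0 → Ω → EuclideanSpace ℝ (Fin n))
    (hW : BrownianHull.IsBrownianMotion W P) :
    AEMeasurable (BrownianHull.inverseDiameterTime W 1) P ∧
      ENNReal.ofReal (1 / (4 * Real.log 2) * (1 / (n : ℝ))) ≤
        ∫⁻ ω, BrownianHull.inverseDiameterTime W 1 ω ∂P ∧
      ∫⁻ ω, BrownianHull.inverseDiameterTime W 1 ω ∂P ≤ ENNReal.ofReal (1 / (n : ℝ)) :=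
  ⟨hW.aemeasurable_inverseDiameterTime 1, hW.lower_bound hn, hW.upper_bound hn⟩
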